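/- **Setting.** For positive integers $d_1,d_2$ let $(X_1,X_2)$ be a random vector with values in $\mathbb R^{d_1}\times\mathbb R^{d_2}$ and joint law $P$, and let $(X_{11},X_{21}),(X_{12},X_{22}),\dots$ be independent copies of it. Let $m\ge 4$ and let $H_*^m=\langle(1\,4),(2\,3)\rangle$, a subgroup of the symmetric group on $\{1,\dots,m\}$. For kernels $f_k:(\mathbb R^{d_k})^m\to[0,\infty)$, $k=1,2$, the *generalized symmetric covariance* (GSC) with kernels $f_1,f_2$ and group $H_*^m$ is $$\mu_{f_1,f_2}(X_1,X_2)=\mathrm E\Big[\prod_{k=1}^2\ \sum_{\sigma\in H_*^m}\mathrm{sgn}(\sigma)\,f_k(X_{k\sigma(1)},\dots,X_{k\sigma(m)})\Big].$$ It is *D-consistent* within a family of joint laws $P$ if, for every $P$ in the family, this expectation is well defined and finite, is nonnegative, and equals $0$ only if $X_1$ and $X_2$ are independent. For $u,v\in\mathbb R^d$ write $u\preceq v$ if $u_\ell\le v_\ell$ for all $\ell$, and let $\mathsf{Arc}(u,v)=(2\pi)^{-1}\arccos\{u^\top v/(\|u\|\|v\|)\}$ if $u,v\neq 0$ and $\mathsf{Arc}(u,v)=0$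 otherwise. Consider the following five GSCs ($k=1,2$, $w=(w_1,\dots,w_m)$): - (a) distance covariance: $m=4$, $f_k(w)=\tfrac12\|w_1-w_2\|$; - (b) Hoeffding's multivariate marginal-ordering $D$: $m=5$, $f_k(w)=\tfrac12\mathbf 1(w_1\preceq w_5\text{ and }w_2\preceq w_5)$; - (c) Hoeffding's multivariate projection-averaging $D$: $m=5$, $f_k(w)=\tfrac12\mathsf{Arc}(w_1-w_5,w_2-w_5)$; - (d) Blum–Kiefer–Rosenblatt's multivariate projection-averaging $R$: $m=6$, $f_1(w)=\tfrac12\mathsf{Arc}(w_1-w_5,w_2-w_5)$, $f_2(w)=\tfrac12\mathsf{Arc}(w_1-w_6,w_2-w_6)$; - (e) Bergsma–Dassios–Yanagimoto's multivariate projection-averaging $\tau^*$: $m=4$, $f_k(w)=\mathsf{Arc}(w_1-w_2,w_2-w_3)+\mathsf{Arc}(w_2-w_1,w_1-w_4)$. **Theorem.** Each of the GSCs (a)–(e) is D-consistent within the family of all probability measures $P$ on $\mathbb R^{d_1+d_2}$ that are absolutely continuous with respect to Lebesgue measure and satisfy $\mathrm E_P[f_k(X_{k1},\dots,X_{km})]<\infty$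 for $k=1,2$, where $f_1,f_2$ are the kernels of that GSC. -/

import Mathlib

open MeasureTheory ProbabilityTheory

/-- A point of `ℝ^d`, with the Euclidean norm and inner product. -/
abbrev Vec (d : ℕ) : Type := EuclideanSpace ℝ (Fin d)

/-- `H_*^m = ⟨(1 4), (2 3)⟩`, as a subgroup of the symmetric group on `m ≥ 4` letters.
The letters `1, …, m` are the elements `0, …, m - 1` of `Fin m`. -/
def HStar (m : ℕ) (hm : 4 ≤ m) : Subgroup (Equiv.Perm (Fin m)) :=
  Subgroup.closure
    {Equiv.swap ⟨0, by omega⟩ ⟨3, by omega⟩, Equiv.swap ⟨1, by omega⟩ ⟨2, by omega⟩}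

theorem HStar_balanced (m : ℕ) (hm : 4 ≤ m) :
    Nat.card {σ : Equiv.Perm (Fin m) // σ ∈ HStar m hm ∧ Equiv.Perm.sign σ = 1} =
      Nat.card {σ : Equiv.Perm (Fin m) // σ ∈ HStar m hm ∧ Equiv.Perm.sign σ = -1} := by
  let τ : Equiv.Perm (Fin m) := Equiv.swap ⟨0, by omega⟩ ⟨3, by omega⟩
  have hτ : τ ∈ HStar m hm := Subgroup.subset_closure (Or.inl rfl)
  have hs : Equiv.Perm.sign τ = -1 := Equiv.Perm.sign_swap (by simp)
  have htt : τ * τ = 1 := Equiv.swap_mul_self _ _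
  refine Nat.card_congr
    { toFun := fun σ => ⟨τ * σ.1, mul_mem hτ σ.2.1, by simp [hs, σ.2.2]⟩
      invFun := fun σ => ⟨τ * σ.1, mul_mem hτ σ.2.1, by simp [hs, σ.2.2]⟩
      left_inv := fun σ => Subtype.ext (by simp [← mul_assoc, htt])
      right_inv := fun σ => Subtype.ext (by simp [← mul_assoc, htt]) }

/-- The data of a generalized symmetric covariance (GSC) of order `m` between an `ℝ^{d₁}`-valued
and an `ℝ^{d₂}`-valued random vector: two nonnegative kernel functions, and a subgroup of the
symmetric group with equally many even and odd permutations. -/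
structure GSC (d₁ d₂ m : ℕ) where
  f₁ : (Fin m → Vec d₁) → ℝ
  f₂ : (Fin m → Vec d₂) → ℝ
  H : Subgroup (Equiv.Perm (Fin m))
  f₁_nonneg : ∀ w, 0 ≤ f₁ w
  f₂_nonneg : ∀ w, 0 ≤ f₂ w
  balanced : Nat.card {σ : Equiv.Perm (Fin m) // σ ∈ H ∧ Equiv.Perm.sign σ = 1} =
    Nat.card {σ : Equiv.Perm (Fin m) // σ ∈ H ∧ Equiv.Perm.sign σ = -1}

open Classical in
/-- The signed sum `∑_{σ ∈ H} sgn(σ) f(w_{σ(1)}, …, w_{σ(m)})`. -/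
noncomputable def signedSum {d m : ℕ} (H : Subgroup (Equiv.Perm (Fin m)))
    (f : (Fin m → Vec d) → ℝ) (w : Fin m → Vec d) : ℝ :=
  ∑ σ : Equiv.Perm (Fin m) with σ ∈ H, ((Equiv.Perm.sign σ : ℤ) : ℝ) * f (fun i => w (σ i))

namespace GSC

/-- The dependence kernel function `k_{f₁,f₂,H}` on `m` points of `ℝ^{d₁} × ℝ^{d₂}`. -/
noncomputable def depKernel {d₁ d₂ m : ℕ} (κ : GSC d₁ d₂ m) (z : Fin m → Vec d₁ × Vec d₂) : ℝ :=
  signedSum κ.H κ.f₁ (fun i => (z i).1) * signedSum κ.H κ.f₂ (fun i => (z i).2)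

/-- The value `μ_{f₁,f₂,H}(X₁, X₂)` when `P` is the joint law of `(X₁, X₂)`: the expectation of the
dependence kernel at `m` independent copies of `(X₁, X₂)`. -/
noncomputable def value {d₁ d₂ m : ℕ} (κ : GSC d₁ d₂ m) (P : Measure (Vec d₁ × Vec d₂)) : ℝ :=
  ∫ z, κ.depKernel z ∂(Measure.pi fun _ : Fin m => P)

/-- The Lebesgue-absolutely continuous laws `P` on `ℝ^{d₁+d₂} = ℝ^{d₁} × ℝ^{d₂}` under which
both kernels, evaluated at `m` independent copies, have a finite expectation. -/
def acFamily {d₁ d₂ m : ℕ} (κ : GSC d₁ d₂ m) : Set (Measure (Vec d₁ × Vec d₂)) :=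
  {P | IsProbabilityMeasure P ∧ P ≪ volume ∧
    Integrable (fun z => κ.f₁ (fun i => (z i).1)) (Measure.pi fun _ : Fin m => P) ∧
    Integrable (fun z => κ.f₂ (fun i => (z i).2)) (Measure.pi fun _ : Fin m => P)}

/-- D-consistency of a GSC within a family of joint laws: for every law in the family, the
expectation that defines the GSC exists and is finite, it is nonnegative, and it vanishes only if
`X₁` and `X₂` (the two coordinates) are independent. -/
def DConsistent {d₁ d₂ m : ℕ} (κ : GSC d₁ d₂ m) (Fam : Set (Measure (Vec d₁ × Vec d₂))) : Prop :=
  ∀ P ∈ Fam, Integrable κ.depKernel (Measure.pi fun _ : Fin m => P) ∧ 0 ≤ κ.value P ∧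
    (κ.value P = 0 → IndepFun (Prod.fst : Vec d₁ × Vec d₂ → Vec d₁) Prod.snd P)

end GSC

open Classical in
/-- `Arc(u, v) = (2π)⁻¹ arccos(uᵀv / (‖u‖ ‖v‖))` if `u, v ≠ 0`, and `0` otherwise. -/
noncomputable def Arc {d : ℕ} (u v : Vec d) : ℝ :=
  if u ≠ 0 ∧ v ≠ 0 then (2 * Real.pi)⁻¹ * Real.arccos (inner ℝ u v / (‖u‖ * ‖v‖)) else 0

theorem Arc_nonneg {d : ℕ} (u v : Vec d) : 0 ≤ Arc u v := by
  unfold Arc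
  split_ifs
  · exact mul_nonneg (inv_nonneg.2 (mul_nonneg zero_le_two Real.pi_pos.le)) (Real.arccos_nonneg _)
  · exact le_rfl

/-- The componentwise order `u ⪯ v` on `ℝ^d`. -/
def CompLE {d : ℕ} (u v : Vec d) : Prop := ∀ l, u l ≤ v l

/-- Kernel of distance covariance: `½ ‖w₁ - w₂‖`. -/
noncomputable def kerDCov {d : ℕ} (w : Fin 4 → Vec d) : ℝ := 1 / 2 * ‖w 0 - w 1‖

open Classical in
/-- Kernel of the marginal-ordering `D`: `½ 1(w₁, w₂ ⪯ w₅)`. -/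
noncomputable def kerM {d : ℕ} (w : Fin 5 → Vec d) : ℝ :=
  1 / 2 * (if CompLE (w 0) (w 4) ∧ CompLE (w 1) (w 4) then 1 else 0)

/-- Kernel of the projection-averaging `D`: `½ Arc(w₁ - w₅, w₂ - w₅)`. -/
noncomputable def kerD {d : ℕ} (w : Fin 5 → Vec d) : ℝ := 1 / 2 * Arc (w 0 - w 4) (w 1 - w 4)

/-- First kernel of the projection-averaging `R`: `½ Arc(w₁ - w₅, w₂ - w₅)`. -/
noncomputable def kerR₁ {d : ℕ} (w : Fin 6 → Vec d) : ℝ := 1 / 2 * Arc (w 0 - w 4) (w 1 - w 4)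

/-- Second kernel of the projection-averaging `R`: `½ Arc(w₁ - w₆, w₂ - w₆)`. -/
noncomputable def kerR₂ {d : ℕ} (w : Fin 6 → Vec d) : ℝ := 1 / 2 * Arc (w 0 - w 5) (w 1 - w 5)

/-- Kernel of the projection-averaging `τ*`: `Arc(w₁ - w₂, w₂ - w₃) + Arc(w₂ - w₁, w₁ - w₄)`. -/
noncomputable def kerTau {d : ℕ} (w : Fin 4 → Vec d) : ℝ :=
  Arc (w 0 - w 1) (w 1 - w 2) + Arc (w 1 - w 0) (w 0 - w 3)

/-- Distance covariance. -/
noncomputable def gscDCov (d₁ d₂ : ℕ) : GSC d₁ d₂ 4 where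
  f₁ := kerDCov
  f₂ := kerDCov
  H := HStar 4 (by norm_num)
  f₁_nonneg _ := mul_nonneg (by norm_num) (norm_nonneg _)
  f₂_nonneg _ := mul_nonneg (by norm_num) (norm_nonneg _)
  balanced := HStar_balanced _ _

/-- Hoeffding's multivariate marginal-ordering `D`. -/
noncomputable def gscM (d₁ d₂ : ℕ) : GSC d₁ d₂ 5 where
  f₁ := kerM
  f₂ := kerM
  H := HStar 5 (by norm_num)
  f₁_nonneg w := by unfold kerM; split_ifs <;> norm_num
  f₂_nonneg w := by unfold kerM; split_ifs <;> norm_num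
  balanced := HStar_balanced _ _

/-- Hoeffding's multivariate projection-averaging `D`. -/
noncomputable def gscD (d₁ d₂ : ℕ) : GSC d₁ d₂ 5 where
  f₁ := kerD
  f₂ := kerD
  H := HStar 5 (by norm_num)
  f₁_nonneg _ := mul_nonneg (by norm_num) (Arc_nonneg _ _)
  f₂_nonneg _ := mul_nonneg (by norm_num) (Arc_nonneg _ _)
  balanced := HStar_balanced _ _

/-- Blum-Kiefer-Rosenblatt's multivariate projection-averaging `R`. -/
noncomputable def gscR (d₁ d₂ : ℕ) : GSC d₁ d₂ 6 where
  f₁ := kerR₁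
  f₂ := kerR₂
  H := HStar 6 (by norm_num)
  f₁_nonneg _ := mul_nonneg (by norm_num) (Arc_nonneg _ _)
  f₂_nonneg _ := mul_nonneg (by norm_num) (Arc_nonneg _ _)
  balanced := HStar_balanced _ _

/-- Bergsma-Dassios-Yanagimoto's multivariate projection-averaging `τ*`. -/
noncomputable def gscTau (d₁ d₂ : ℕ) : GSC d₁ d₂ 4 where
  f₁ := kerTau
  f₂ := kerTau
  H := HStar 4 (by norm_num)
  f₁_nonneg _ := add_nonneg (Arc_nonneg _ _) (Arc_nonneg _ _)
  f₂_nonneg _ := add_nonneg (Arc_nonneg _ _) (Arc_nonneg _ _)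
  balanced := HStar_balanced _ _

/-! The engine is the alternating product `alt x = (x₁ - x₄)(x₂ - x₃)`. For bounded `h`, `g` and
four independent copies of `(X₁, X₂)`, the expectation of `alt (h) * alt (g)` splits over the
independent pairs `{1, 4}` and `{2, 3}` and equals `4 Cov(h, g)²` (`integral_alt_mul_alt`). A GSC
whose signed sums are averages of alternating products of indicators is therefore an average of
squared covariances: it is nonnegative, and if it vanishes then almost all of these covariances
vanish.

The signed sums have this form by integral geometry. In (b) the indicator is that of an orthant with
corner `w₅`. In (c) and (d), Sheppard's formula writes `Arc(u, v)` as the probability that a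
Gaussian direction `θ` satisfies `θ·u > 0 ≥ θ·v`, which gives indicators of half-spaces with a
sample point on the boundary. In (a), Crofton's formula writes `‖x - y‖` as a multiple of the
measure of the half-spaces separating `x` and `y`.

Case (e) averages the bivariate sign covariance over projections. Two symmetrized identities on five
points, finite statements about ranks, express its expectation for a law `Q` with marginals `Q₁`,
`Q₂` as `12 ∫ (F - F₁F₂)² dQ + 24 ∫ (F - F₁F₂)² d(Q₁ ⊗ Q₂)`.

Vanishing covariances say that the distribution functions of the law and of the product of its
marginals agree almost everywhere, but only with respect to one of these two measures. Absolute
continuity closes this gap: an integrable function vanishes almost everywhere on the zero set of its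
distribution function, so the densities agree where one of them is positive, and equal total mass
does the rest (`HasZeroSetProperty.eq_of_ae_eq`). In (a), (c), (d) and (e) this is applied to the
projections `(θ₁·X₁, θ₂·X₂)`; independence for almost all directions yields independence of `X₁` and
`X₂` by continuity of characteristic functions. -/

/-! ### Zero sets of distribution functions -/

open Filter Set Topology in
/-- On the line, an integrable function vanishes almost everywhere on the zero set of its
primitive. -/
theorem ae_eq_zero_of_primitive_eq_zero {φ : ℝ → ℝ} (hφ : Integrable φ) :
    ∀ᵐ x, ∫ u in Set.Iic x, φ u = 0 → φ x = 0 := by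
  set Φ : ℝ → ℝ := fun x => ∫ u in Iic x, φ u with hΦ
  have hder : ∀ᵐ x, HasDerivAt Φ (φ x) x := by
    filter_upwards [LocallyIntegrable.ae_hasDerivAt_integral hφ.locallyIntegrable] with x hx
    have h0 : Φ = fun y => Φ 0 + ∫ t in (0 : ℝ)..y, φ t := by
      funext y
      rw [intervalIntegral.integral_Iic_sub_Iic hφ.integrableOn hφ.integrableOn |>.symm]
      simp [hΦ]
    rw [h0]
    exact (hx 0).const_add _
  -- Zeros of the primitive with nonzero derivative are isolated among its zeros, so they form a
  -- discrete subset of the line, which is countable and hence null.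
  set N : Set ℝ := {x | Φ x = 0 ∧ φ x ≠ 0 ∧ HasDerivAt Φ (φ x) x} with hN
  have hdisc : DiscreteTopology N := by
    rw [discreteTopology_subtype_iff]
    rintro x ⟨hx0, hx1, hx2⟩
    have h := hx2.eventually_ne hx1 (c := 0)
    rw [← disjoint_iff, Filter.disjoint_principal_right]
    filter_upwards [h] with z hz hzN
    exact hz hzN.1
  have hc : N.Countable := by
    have : Countable N := TopologicalSpace.separableSpace_iff_countable.1 inferInstance
    exact Set.to_countable N
  filter_upwards [hder, hc.ae_notMem volume] with x h1 h2 h3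
  by_contra h4
  exact h2 ⟨h3, h4, h1⟩

/-- A measure space with an order-like relation on which an integrable function vanishes almost
everywhere on the zero set of its distribution function. -/
def HasZeroSetProperty {E : Type*} [MeasurableSpace E] (μ : Measure E) (r : E → E → Prop) : Prop :=
  MeasurableSet {p : E × E | r p.1 p.2} ∧ ∀ φ : E → ℝ, Measurable φ → Integrable φ μ →
    ∀ᵐ x ∂μ, ∫ u in {u | r u x}, φ u ∂μ = 0 → φ x = 0

theorem hasZeroSetProperty_real : HasZeroSetProperty (volume : Measure ℝ) (· ≤ ·) :=
  ⟨measurableSet_le measurable_fst measurable_snd,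
    fun _ _ hφ => ae_eq_zero_of_primitive_eq_zero hφ⟩

theorem hasZeroSetProperty_of_subsingleton {E : Type*} [MeasurableSpace E] [Subsingleton E]
    (μ : Measure E) [NeZero μ] [IsFiniteMeasure μ] {r : E → E → Prop} (hr : ∀ x, r x x) :
    HasZeroSetProperty μ r := by
  refine ⟨Subsingleton.measurableSet, fun φ _ _ => ae_of_all _ fun x hx => ?_⟩
  have h1 : {u | r u x} = Set.univ := by
    ext u; simpa [Subsingleton.elim u x] using hr x
  have h2 : φ = fun _ => φ x := by ext y; rw [Subsingleton.elim y x]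
  rw [h1, h2] at hx
  simpa [measureReal_def, ENNReal.toReal_eq_zero_iff, NeZero.ne μ] using hx

theorem measurable_setIntegral_rel {E F : Type*} [MeasurableSpace E] [MeasurableSpace F]
    {ν : Measure F} [SFinite ν] {r : F → F → Prop}
    (hr : MeasurableSet {p : F × F | r p.1 p.2}) {φ : E × F → ℝ} (hφ : Measurable φ) :
    Measurable fun p : E × F => ∫ v in {v | r v p.2}, φ (p.1, v) ∂ν := by
  have h1 : ∀ p : E × F, ∫ v in {v | r v p.2}, φ (p.1, v) ∂ν =
      ∫ v, Set.indicator {q : (E × F) × F | r q.2 q.1.2} (fun q => φ (q.1.1, q.2)) (p, v) ∂ν := by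
    intro p
    have hm : MeasurableSet {v | r v p.2} := hr.preimage (measurable_id.prodMk measurable_const)
    rw [← integral_indicator hm]
    rfl
  simp_rw [h1]
  refine (StronglyMeasurable.integral_prod_right ?_).measurable
  refine Measurable.stronglyMeasurable ?_
  exact (by fun_prop : Measurable fun q : (E × F) × F => φ (q.1.1, q.2)).indicator
    (hr.preimage (by fun_prop : Measurable fun q : (E × F) × F => (q.2, q.1.2)))

/-- The distribution function of `φ` is obtained by integrating first in the second variable, which
gives `ψ`, and then `ψ` in the first. By Fubini the one-factor property applies on slices: the
double primitive being zero forces `ψ = 0`, and this forces `φ = 0`, each time almost everywhere. -/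
theorem HasZeroSetProperty.prod {E F : Type*} [MeasurableSpace E] [MeasurableSpace F]
    {μ : Measure E} {ν : Measure F} [SFinite μ] [SFinite ν]
    {r : E → E → Prop} {s : F → F → Prop} (hμ : HasZeroSetProperty μ r)
    (hν : HasZeroSetProperty ν s) :
    HasZeroSetProperty (μ.prod ν) (fun p q => r p.1 q.1 ∧ s p.2 q.2) := by
  have hm : MeasurableSet {p : (E × F) × (E × F) | r p.1.1 p.2.1 ∧ s p.1.2 p.2.2} :=
    (hμ.1.preimage (by fun_prop : Measurable fun p : (E × F) × (E × F) => (p.1.1, p.2.1))).inter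
    (hν.1.preimage (by fun_prop : Measurable fun p : (E × F) × (E × F) => (p.1.2, p.2.2)))
  refine ⟨hm, fun φ hφ hi => ?_⟩
  -- partial distribution function in the second variable
  set ψ : E × F → ℝ := fun p => ∫ v in {v | s v p.2}, φ (p.1, v) ∂ν with hψ
  have hψm : Measurable ψ := measurable_setIntegral_rel hν.1 hφ
  have hsl : ∀ y, MeasurableSet {v | s v y} := fun y =>
    hν.1.preimage (measurable_id.prodMk measurable_const)
  have hrl : ∀ y, MeasurableSet {v | r v y} := fun y =>
    hμ.1.preimage (measurable_id.prodMk measurable_const)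
  have hψi : ∀ y, Integrable (fun x => ψ (x, y)) μ := by
    intro y
    have : Integrable φ (μ.prod (ν.restrict {v | s v y})) := by
      have h := hi.integrableOn (s := Set.univ ×ˢ {v | s v y})
      rwa [IntegrableOn, ← Measure.prod_restrict, Measure.restrict_univ] at h
    exact this.integral_prod_left
  have hΦ : ∀ p : E × F, ∫ u in {u | r u.1 p.1 ∧ s u.2 p.2}, φ u ∂(μ.prod ν) =
      ∫ x in {x | r x p.1}, ψ (x, p.2) ∂μ := by
    intro p
    have h1 : {u : E × F | r u.1 p.1 ∧ s u.2 p.2} = {x | r x p.1} ×ˢ {v | s v p.2} := rfl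
    rw [h1, setIntegral_prod _ hi.integrableOn]
  have hΦm : Measurable fun p : E × F => ∫ x in {x | r x p.1}, ψ (x, p.2) ∂μ := by
    have := measurable_setIntegral_rel (ν := μ) hμ.1 (φ := fun q : F × E => ψ (q.2, q.1))
      (by fun_prop)
    exact this.comp measurable_swap
  have hz : MeasurableSet ({0} : Set ℝ) := measurableSet_singleton 0
  -- first variable
  have hA : ∀ᵐ p ∂(μ.prod ν), ∫ x in {x | r x p.1}, ψ (x, p.2) ∂μ = 0 → ψ p = 0 := by
    have hset : MeasurableSet {p : E × F | ∫ x in {x | r x p.1}, ψ (x, p.2) ∂μ = 0 → ψ p = 0} := by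
      simp only [imp_iff_not_or]
      exact (hΦm hz).compl.union (hψm hz)
    rw [Measure.ae_prod_iff_ae_ae hset, Measure.ae_ae_comm hset]
    exact ae_of_all _ fun y => hμ.2 _ (hψm.comp (measurable_id.prodMk measurable_const)) (hψi y)
  have hB : ∀ᵐ p ∂(μ.prod ν), ψ p = 0 → φ p = 0 := by
    have hset : MeasurableSet {p : E × F | ψ p = 0 → φ p = 0} := by
      simp only [imp_iff_not_or]
      exact (hψm hz).compl.union (hφ hz)
    rw [Measure.ae_prod_iff_ae_ae hset]
    filter_upwards [hi.prod_right_ae] with x hx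
    exact hν.2 _ (hφ.comp (measurable_const.prodMk measurable_id)) hx
  filter_upwards [hA, hB] with p h1 h2 h3
  rw [hΦ] at h3
  exact h2 (h1 h3)

theorem HasZeroSetProperty.of_measurePreserving {E F : Type*} [MeasurableSpace E]
    [MeasurableSpace F] {μ : Measure E} {ν : Measure F} {r : E → E → Prop} {s : F → F → Prop}
    (hμ : HasZeroSetProperty μ r) (e : F ≃ᵐ E) (he : MeasurePreserving e ν μ)
    (hrs : ∀ x y, s x y ↔ r (e x) (e y)) : HasZeroSetProperty ν s := by
  refine ⟨?_, fun φ hφ hi => ?_⟩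
  · simp only [hrs]
    exact hμ.1.preimage (by fun_prop : Measurable fun p : F × F => (e p.1, e p.2))
  · have h := hμ.2 (φ ∘ e.symm) (hφ.comp e.symm.measurable)
      ((he.symm e).integrable_comp_of_integrable hi)
    have h2 := he.quasiMeasurePreserving.ae h
    filter_upwards [h2] with x hx h3
    have h4 : ∫ u in {u | r u (e x)}, (φ ∘ e.symm) u ∂μ = 0 := by
      rw [← he.setIntegral_preimage_emb e.measurableEmbedding]
      simpa [Set.preimage, hrs] using h3
    simpa using hx h4

theorem hasZeroSetProperty_pi (d : ℕ) :
    HasZeroSetProperty (volume : Measure (Fin d → ℝ)) (fun u v => ∀ l, u l ≤ v l) := by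
  induction d with
  | zero =>
    have : IsProbabilityMeasure (volume : Measure (Fin 0 → ℝ)) := by
      rw [volume_pi, Measure.pi_of_empty]; infer_instance
    exact hasZeroSetProperty_of_subsingleton _ fun x l => le_rfl
  | succ n ih =>
    refine (hasZeroSetProperty_real.prod ih).of_measurePreserving
      (MeasurableEquiv.piFinSuccAbove (fun _ => ℝ) 0)
      (volume_preserving_piFinSuccAbove (fun _ : Fin (n + 1) => ℝ) 0) fun x y => ?_
    simp [Fin.forall_fin_succ, MeasurableEquiv.piFinSuccAbove, Fin.insertNthEquiv, Fin.tail]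

theorem hasZeroSetProperty_vec (d : ℕ) :
    HasZeroSetProperty (volume : Measure (Vec d)) CompLE :=
  (hasZeroSetProperty_pi d).of_measurePreserving
    (MeasurableEquiv.toLp 2 (Fin d → ℝ)).symm
    ((EuclideanSpace.volume_preserving_symm_measurableEquiv_toLp (Fin d))) fun _ _ => Iff.rfl

/-- Two absolutely continuous probability measures agree as soon as their distribution functions
agree almost everywhere for one of them. -/
theorem HasZeroSetProperty.eq_of_ae_eq {E : Type*} [MeasurableSpace E] {μ : Measure E}
    [SigmaFinite μ] {r : E → E → Prop} (h : HasZeroSetProperty μ r) {P Q : Measure E}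
    [IsProbabilityMeasure P] [IsProbabilityMeasure Q] (hP : P ≪ μ) (hQ : Q ≪ μ)
    (hPQ : ∀ᵐ x ∂P, P.real {u | r u x} = Q.real {u | r u x}) : P = Q := by
  set f : E → ℝ := fun x => (P.rnDeriv μ x).toReal with hf
  set g : E → ℝ := fun x => (Q.rnDeriv μ x).toReal with hg
  have hfm : Measurable f := (P.measurable_rnDeriv μ).ennreal_toReal
  have hgm : Measurable g := (Q.measurable_rnDeriv μ).ennreal_toReal
  have hfi : Integrable f μ := Measure.integrable_toReal_rnDeriv
  have hgi : Integrable g μ := Measure.integrable_toReal_rnDeriv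
  have hfI : ∀ s, ∫ x in s, f x ∂μ = P.real s := fun s => Measure.setIntegral_toReal_rnDeriv hP s
  have hgI : ∀ s, ∫ x in s, g x ∂μ = Q.real s := fun s => Measure.setIntegral_toReal_rnDeriv hQ s
  have hfg := h.2 (fun x => f x - g x) (hfm.sub hgm) (hfi.sub hgi)
  have hfz : ∀ᵐ x ∂μ, f x ≠ 0 → P.real {u | r u x} = Q.real {u | r u x} := by
    rw [← Measure.withDensity_rnDeriv_eq P μ hP,
      ae_withDensity_iff (P.measurable_rnDeriv μ)] at hPQ
    filter_upwards [hPQ] with x hx hfx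
    have hx' := hx (by
      intro h0
      exact hfx (by simp [hf, h0]))
    simpa [Measure.withDensity_rnDeriv_eq P μ hP] using hx'
  -- Where `f > 0` the distribution functions agree, so `f = g` there almost everywhere; elsewhere
  -- `f = 0 ≤ g`. Since both densities have integral one, `f ≤ g` is an equality.
  have hle : f ≤ᵐ[μ] g := by
    filter_upwards [hfg, hfz] with x h1 h2
    by_cases h0 : f x = 0
    · rw [h0]; exact ENNReal.toReal_nonneg
    · have := h1 (by
        rw [integral_sub hfi.integrableOn hgi.integrableOn, hfI, hgI, h2 h0, sub_self])
      linarith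
  have heq : f =ᵐ[μ] g := by
    have hI : ∫ x, (g x - f x) ∂μ = 0 := by
      have h1 := hfI Set.univ
      have h2 := hgI Set.univ
      simp only [Measure.restrict_univ, probReal_univ] at h1 h2
      rw [integral_sub hgi hfi, h1, h2, sub_self]
    rw [integral_eq_zero_iff_of_nonneg_ae (f := fun x => g x - f x) _ (hgi.sub hfi)] at hI
    · filter_upwards [hI] with x hx
      simp only [Pi.zero_apply] at hx
      linarith
    · filter_upwards [hle] with x hx
      simpa using hx
  rw [← Measure.withDensity_rnDeriv_eq P μ hP, ← Measure.withDensity_rnDeriv_eq Q μ hQ]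
  refine withDensity_congr_ae ?_
  filter_upwards [heq, P.rnDeriv_lt_top μ, Q.rnDeriv_lt_top μ] with x h1 h2 h3
  exact (ENNReal.toReal_eq_toReal_iff' h2.ne h3.ne).1 h1

/-! ### Independent samples -/

section PowerMeasure

variable {α β : Type*} [MeasurableSpace α] [MeasurableSpace β] (P : Measure α)
  [IsProbabilityMeasure P]

/-- Selecting distinct coordinates of an independent sample gives an independent sample. -/
theorem measurePreserving_pi_comp {ι κ : Type*} [Fintype ι] [Fintype κ] {e : κ → ι}
    (he : Function.Injective e) :
    MeasurePreserving (fun (z : ι → α) i => z (e i)) (Measure.pi fun _ => P)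
      (Measure.pi fun _ => P) := by
  refine ⟨by fun_prop, ?_⟩
  have h := (iIndepFun_pi (μ := fun _ : ι => P) (X := fun _ => id)
    fun _ => aemeasurable_id).precomp he
  simp only [id] at h
  rw [iIndepFun_iff_map_fun_eq_pi_map fun i => (measurable_pi_apply (e i)).aemeasurable] at h
  rw [h]
  congr
  ext1 i
  exact (measurePreserving_eval (fun _ : ι => P) (e i)).map_eq

/-- Two disjoint blocks of an independent sample are independent samples. -/
theorem measurePreserving_pi_sum {ι κ τ : Type*} [Fintype ι] [Fintype κ] [Fintype τ]
    {e : ι ⊕ κ → τ} (he : Function.Injective e) :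
    MeasurePreserving (fun z : τ → α => (fun i => z (e (.inl i)), fun i => z (e (.inr i))))
      (Measure.pi fun _ => P) ((Measure.pi fun _ => P).prod (Measure.pi fun _ => P)) :=
  (measurePreserving_sumPiEquivProdPi fun _ : ι ⊕ κ => P).comp (measurePreserving_pi_comp P he)

theorem measurePreserving_pi_pair {τ : Type*} [Fintype τ] {i j : τ} (hij : i ≠ j) :
    MeasurePreserving (fun z : τ → α => (z i, z j)) (Measure.pi fun _ => P) (P.prod P) := by
  have h := (measurePreserving_funUnique P Unit).prod (measurePreserving_funUnique P Unit)
  refine h.comp (measurePreserving_pi_sum P (e := Sum.elim (fun _ : Unit => i) fun _ : Unit => j) ?_)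
  rintro (_ | _) (_ | _) h <;> simp_all

theorem measurePreserving_pi_map {τ : Type*} [Fintype τ] {f : α → β} (hf : Measurable f) :
    MeasurePreserving (fun (z : τ → α) i => f (z i)) (Measure.pi fun _ => P)
      (Measure.pi fun _ => P.map f) := by
  have := Measure.isProbabilityMeasure_map (μ := P) hf.aemeasurable
  exact ⟨by fun_prop, Measure.pi_map_pi fun _ => hf.aemeasurable⟩

/-- The coordinates of an independent sample from an atomless law are distinct. -/
theorem ae_pi_injective {τ : Type*} [Fintype τ] {f : α → β} (hf : Measurable f)
    [MeasurableEq β] (hP : ∀ b, P {x | f x = b} = 0) :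
    ∀ᵐ z ∂(Measure.pi fun _ : τ => P), Function.Injective fun i => f (z i) := by
  have h : ∀ i j : τ, i ≠ j → ∀ᵐ z ∂(Measure.pi fun _ : τ => P), f (z i) ≠ f (z j) := by
    intro i j hij
    have hm : MeasurableSet {p : α × α | f p.1 ≠ f p.2} :=
      (measurableSet_eq_fun (by fun_prop) (by fun_prop)).compl
    have h2 : ∀ᵐ p ∂(P.prod P), f p.1 ≠ f p.2 := by
      rw [Measure.ae_prod_iff_ae_ae hm]
      refine ae_of_all _ fun x => ?_
      rw [ae_iff]
      simpa [eq_comm] using hP (f x)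
    exact (measurePreserving_pi_pair P hij).quasiMeasurePreserving.ae h2
  have h' : ∀ᵐ z ∂(Measure.pi fun _ : τ => P), ∀ i j : τ, i ≠ j → f (z i) ≠ f (z j) := by
    rw [ae_all_iff]; intro i
    rw [ae_all_iff]; intro j
    by_cases hij : i = j
    · simp [hij]
    · simpa [hij] using h i j hij
  filter_upwards [h'] with z hz i j hij
  by_contra hne
  exact hz i j hne hij

end PowerMeasure

/-! ### Alternating products and squared covariances -/

/-- The alternating product `(x₁ - x₄) (x₂ - x₃)`. -/
def alt (x : Fin 4 → ℝ) : ℝ := (x 0 - x 3) * (x 1 - x 2)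

theorem abs_alt_le {x : Fin 4 → ℝ} (hx : ∀ i, |x i| ≤ 1) : |alt x| ≤ 4 := by
  have h : ∀ i j, |x i - x j| ≤ 2 := fun i j =>
    (abs_sub _ _).trans (by linarith [hx i, hx j])
  rw [alt, abs_mul]
  nlinarith [h 0 3, h 1 2, abs_nonneg (x 0 - x 3), abs_nonneg (x 1 - x 2)]

@[fun_prop]
theorem measurable_alt : Measurable alt := by
  unfold alt; fun_prop

section Covariance

variable {α : Type*} [MeasurableSpace α] (P : Measure α) [IsProbabilityMeasure P]

theorem integrable_of_abs_le {α : Type*} [MeasurableSpace α] {μ : Measure α} [IsFiniteMeasure μ]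
    {f : α → ℝ} (hf : Measurable f) {C : ℝ} (hC : ∀ x, |f x| ≤ C) : Integrable f μ :=
  Integrable.of_bound hf.aestronglyMeasurable C (ae_of_all _ hC)

theorem integral_sub_mul_sub_prod {h g : α → ℝ} (hm : Measurable h) (gm : Measurable g)
    (hb : ∀ x, |h x| ≤ 1) (gb : ∀ x, |g x| ≤ 1) :
    ∫ p, (h p.1 - h p.2) * (g p.1 - g p.2) ∂(P.prod P) =
      2 * (∫ x, h x * g x ∂P - (∫ x, h x ∂P) * ∫ x, g x ∂P) := by
  have hi : Integrable h P := integrable_of_abs_le hm hb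
  have gi : Integrable g P := integrable_of_abs_le gm gb
  have hgb : ∀ x y, |h x * g y| ≤ 1 := fun x y => by
    rw [abs_mul]; exact mul_le_one₀ (hb x) (abs_nonneg _) (gb y)
  have i1 : Integrable (fun p : α × α => h p.1 * g p.1) (P.prod P) :=
    integrable_of_abs_le (by fun_prop) fun _ => hgb _ _
  have i2 : Integrable (fun p : α × α => h p.1 * g p.2) (P.prod P) :=
    integrable_of_abs_le (by fun_prop) fun _ => hgb _ _
  have i3 : Integrable (fun p : α × α => h p.2 * g p.1) (P.prod P) :=
    integrable_of_abs_le (by fun_prop) fun _ => hgb _ _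
  have i4 : Integrable (fun p : α × α => h p.2 * g p.2) (P.prod P) :=
    integrable_of_abs_le (by fun_prop) fun _ => hgb _ _
  have e : ∀ p : α × α, (h p.1 - h p.2) * (g p.1 - g p.2) =
      (h p.1 * g p.1 - h p.1 * g p.2) - (h p.2 * g p.1 - h p.2 * g p.2) := fun p => by ring
  have j1 : ∫ p : α × α, h p.1 * g p.1 ∂(P.prod P) = ∫ x, h x * g x ∂P := by
    simpa using integral_fun_fst (μ := P) (ν := P) fun x => h x * g x
  have j4 : ∫ p : α × α, h p.2 * g p.2 ∂(P.prod P) = ∫ x, h x * g x ∂P := by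
    simpa using integral_fun_snd (μ := P) (ν := P) fun x => h x * g x
  have j2 : ∫ p : α × α, h p.1 * g p.2 ∂(P.prod P) = (∫ x, h x ∂P) * ∫ x, g x ∂P :=
    integral_prod_mul h g
  have j3 : ∫ p : α × α, h p.2 * g p.1 ∂(P.prod P) = (∫ x, h x ∂P) * ∫ x, g x ∂P := by
    simp_rw [mul_comm (h _) (g _)]
    rw [integral_prod_mul g h, mul_comm]
  simp_rw [e]
  rw [integral_sub, integral_sub i1 i2, integral_sub i3 i4, j1, j2, j3, j4]
  · ring
  · exact i1.sub i2
  · exact i3.sub i4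

/-- The covariance of `h` and `g` under `P`, as a difference of integrals. -/
noncomputable def covar (h g : α → ℝ) : ℝ :=
  ∫ x, h x * g x ∂P - (∫ x, h x ∂P) * ∫ x, g x ∂P

theorem measurePreserving_pi_outer_inner :
    MeasurePreserving (fun z : Fin 4 → α => ((z 0, z 3), (z 1, z 2)))
      (Measure.pi fun _ => P) ((P.prod P).prod (P.prod P)) := by
  have e1 := measurePreserving_pi_pair P (τ := Fin 2) (i := 0) (j := 1) (by simp)
  refine (e1.prod e1).comp (measurePreserving_pi_sum P (ι := Fin 2) (κ := Fin 2)
    (e := Sum.elim ![0, 3] ![1, 2]) ?_)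
  decide

/-- The product regroups into one factor `(h - h')(g - g')` on the points `0, 3` and another on `1,
2`. These are independent, and each has expectation twice the covariance. -/
theorem integral_alt_mul_alt {h g : α → ℝ} (hm : Measurable h) (gm : Measurable g)
    (hb : ∀ x, |h x| ≤ 1) (gb : ∀ x, |g x| ≤ 1) :
    ∫ z, alt (fun i => h (z i)) * alt (fun i => g (z i)) ∂(Measure.pi fun _ : Fin 4 => P) =
      4 * covar P h g ^ 2 := by
  set F : α × α → ℝ := fun p => (h p.1 - h p.2) * (g p.1 - g p.2) with hF
  have mp := measurePreserving_pi_outer_inner P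
  have e : ∀ z : Fin 4 → α, alt (fun i => h (z i)) * alt (fun i => g (z i)) =
      (fun q : (α × α) × (α × α) => F q.1 * F q.2) ((z 0, z 3), (z 1, z 2)) := fun z => by
    simp only [hF, alt]; ring
  simp_rw [e]
  have hFm : Measurable F := by fun_prop
  have hmap := integral_map (μ := Measure.pi fun _ : Fin 4 => P) mp.measurable.aemeasurable
    (f := fun q : (α × α) × (α × α) => F q.1 * F q.2)
    (by fun_prop : Measurable _).aestronglyMeasurable
  rw [mp.map_eq] at hmap
  rw [← hmap, integral_prod_mul F F, hF, integral_sub_mul_sub_prod P hm gm hb gb, covar]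
  ring

/-- Conditional form of `integral_alt_mul_alt`: the points indexed by `κ` supply the thresholds, and
are independent of the four points that enter `alt`. -/
theorem integral_alt_mul_alt_param {κ : Type*} [Fintype κ] {m : ℕ} {e : Fin 4 ⊕ κ → Fin m}
    (he : Function.Injective e) {h g : (κ → α) → α → ℝ}
    (hm : Measurable (Function.uncurry h)) (gm : Measurable (Function.uncurry g))
    (hb : ∀ w x, |h w x| ≤ 1) (gb : ∀ w x, |g w x| ≤ 1) :
    ∫ z, alt (fun i => h (fun j => z (e (.inr j))) (z (e (.inl i)))) *
        alt (fun i => g (fun j => z (e (.inr j))) (z (e (.inl i)))) ∂(Measure.pi fun _ => P) =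
      ∫ w, 4 * covar P (h w) (g w) ^ 2 ∂(Measure.pi fun _ => P) := by
  have mp := measurePreserving_pi_sum P he
  set G : (Fin 4 → α) × (κ → α) → ℝ := fun q =>
    alt (fun i => h q.2 (q.1 i)) * alt (fun i => g q.2 (q.1 i)) with hG
  have hGm : Measurable G := by
    have h1 : ∀ i, Measurable fun q : (Fin 4 → α) × (κ → α) => h q.2 (q.1 i) := fun i =>
      hm.comp (by fun_prop : Measurable fun q : (Fin 4 → α) × (κ → α) => (q.2, q.1 i))
    have h2 : ∀ i, Measurable fun q : (Fin 4 → α) × (κ → α) => g q.2 (q.1 i) := fun i =>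
      gm.comp (by fun_prop : Measurable fun q : (Fin 4 → α) × (κ → α) => (q.2, q.1 i))
    fun_prop
  have hGb : ∀ q, |G q| ≤ 16 := fun q => by
    rw [hG, abs_mul]
    have h1 := abs_alt_le fun i => hb q.2 (q.1 i)
    have h2 := abs_alt_le fun i => gb q.2 (q.1 i)
    nlinarith [abs_nonneg (alt fun i => h q.2 (q.1 i)), abs_nonneg (alt fun i => g q.2 (q.1 i))]
  have hmap := integral_map (μ := Measure.pi fun _ : Fin m => P) mp.measurable.aemeasurable
    (f := G) hGm.aestronglyMeasurable
  rw [mp.map_eq] at hmap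
  rw [← hmap, integral_prod_symm _ (integrable_of_abs_le hGm hGb)]
  refine integral_congr_ae (ae_of_all _ fun w => ?_)
  exact integral_alt_mul_alt P (hm.comp (by fun_prop : Measurable fun x => (w, x)))
    (gm.comp (by fun_prop : Measurable fun x => (w, x))) (hb w) (gb w)

end Covariance

/-! ### Gaussian directions: Sheppard's formula and absolute moments -/

/-- The standard Gaussian measure on the plane. -/
noncomputable abbrev planeGaussian : Measure (ℝ × ℝ) :=
  (gaussianReal 0 1).prod (gaussianReal 0 1)

-- The density depends on the radius only, so in polar coordinates the mass of a cone is a radial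
-- constant times an angular length. The constant may stay unevaluated: normalization determines it
-- in `planeGaussian_cone`.
open Real in
theorem planeGaussian_cone_aux {A : Set (ℝ × ℝ)} {W : Set ℝ} (hA : MeasurableSet A)
    (hW : MeasurableSet W)
    (h : ∀ r ψ : ℝ, 0 < r → ψ ∈ Set.Ioo (-π) π → ((r * cos ψ, r * sin ψ) ∈ A ↔ ψ ∈ W)) :
    planeGaussian A =
      (∫⁻ r in Set.Ioi (0 : ℝ), ENNReal.ofReal (r * ((2 * π)⁻¹ * exp (-r ^ 2 / 2)))) *
        volume (W ∩ Set.Ioo (-π) π) := by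
  have hd : planeGaussian = (volume : Measure (ℝ × ℝ)).withDensity
      fun z => gaussianPDF 0 1 z.1 * gaussianPDF 0 1 z.2 := by
    rw [planeGaussian, gaussianReal_of_var_ne_zero 0 one_ne_zero,
      prod_withDensity (measurable_gaussianPDF 0 1) (measurable_gaussianPDF 0 1)]
    rfl
  have hp : ∀ z : ℝ × ℝ, gaussianPDF 0 1 z.1 * gaussianPDF 0 1 z.2 =
      ENNReal.ofReal ((2 * π)⁻¹ * exp (-(z.1 ^ 2 + z.2 ^ 2) / 2)) := by
    intro z
    rw [gaussianPDF_def, ← ENNReal.ofReal_mul (gaussianPDFReal_nonneg _ _ _), gaussianPDFReal_def]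
    congr 1
    have h1 : (√(2 * π))⁻¹ * (√(2 * π))⁻¹ = (2 * π)⁻¹ := by
      rw [← mul_inv, Real.mul_self_sqrt (by positivity)]
    have h2 : exp (-(z.1 ^ 2 + z.2 ^ 2) / 2) = exp (-z.1 ^ 2 / 2) * exp (-z.2 ^ 2 / 2) := by
      rw [← Real.exp_add]; congr 1; ring
    simp only [NNReal.coe_one, mul_one, sub_zero]
    rw [h2, ← h1]; ring
  rw [hd, withDensity_apply _ hA, ← lintegral_indicator hA, ← lintegral_comp_polarCoord_symm,
    polarCoord_target]
  have hc : ∀ p ∈ Set.Ioi (0 : ℝ) ×ˢ Set.Ioo (-π) π,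
      ENNReal.ofReal p.1 • A.indicator (fun z => gaussianPDF 0 1 z.1 * gaussianPDF 0 1 z.2)
        (polarCoord.symm p) =
      ENNReal.ofReal (p.1 * ((2 * π)⁻¹ * exp (-p.1 ^ 2 / 2))) * W.indicator 1 p.2 := by
    rintro ⟨r, ψ⟩ ⟨hr, hψ⟩
    have hr' : 0 < r := hr
    rw [polarCoord_symm_apply]
    by_cases hw : ψ ∈ W
    · rw [Set.indicator_of_mem ((h r ψ hr hψ).2 hw), Set.indicator_of_mem hw, hp]
      have : (r * cos ψ) ^ 2 + (r * sin ψ) ^ 2 = r ^ 2 := by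
        linear_combination r ^ 2 * Real.sin_sq_add_cos_sq ψ
      simp only [this, smul_eq_mul, Pi.one_apply, mul_one]
      rw [← ENNReal.ofReal_mul hr'.le]
    · rw [Set.indicator_of_notMem (fun h' => hw ((h r ψ hr hψ).1 h')),
        Set.indicator_of_notMem hw]
      simp
  rw [setLIntegral_congr_fun (measurableSet_Ioi.prod measurableSet_Ioo) hc,
    Measure.volume_eq_prod, ← Measure.prod_restrict]
  rw [lintegral_prod_mul (f := fun r => ENNReal.ofReal (r * ((2 * π)⁻¹ * exp (-r ^ 2 / 2))))
    (g := W.indicator 1) (by fun_prop)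
    ((measurable_one.indicator hW).aemeasurable), lintegral_indicator_one hW,
    Measure.restrict_apply hW]

open Real in
theorem planeGaussian_cone {A : Set (ℝ × ℝ)} {W : Set ℝ} (hA : MeasurableSet A)
    (hW : MeasurableSet W)
    (h : ∀ r ψ : ℝ, 0 < r → ψ ∈ Set.Ioo (-π) π → ((r * cos ψ, r * sin ψ) ∈ A ↔ ψ ∈ W)) :
    planeGaussian.real A = (2 * π)⁻¹ * volume.real (W ∩ Set.Ioo (-π) π) := by
  -- The whole plane is a cone of angular length `2π` and mass one, so the radial constant is
  -- `(2π)⁻¹`.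
  have h1 := planeGaussian_cone_aux MeasurableSet.univ MeasurableSet.univ
    (fun r ψ _ _ => ⟨fun _ => Set.mem_univ ψ, fun _ => Set.mem_univ (r * cos ψ, r * sin ψ)⟩)
  have h2 := planeGaussian_cone_aux hA hW h
  set K := ∫⁻ r in Set.Ioi (0 : ℝ), ENNReal.ofReal (r * ((2 * π)⁻¹ * exp (-r ^ 2 / 2)))
  rw [measure_univ, Set.univ_inter, Real.volume_Ioo] at h1
  have h3 : K.toReal = (2 * π)⁻¹ := by
    have h4 := congrArg ENNReal.toReal h1
    rw [ENNReal.toReal_mul, ENNReal.toReal_ofReal (by linarith [pi_pos]), ENNReal.toReal_one] at h4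
    rw [eq_inv_of_mul_eq_one_left (a := K.toReal) (b := 2 * π) (by linarith)]
  rw [measureReal_def, h2, ENNReal.toReal_mul, h3, measureReal_def]

-- At polar angle `ψ` the conditions read `cos ψ > 0` and `cos (ψ - α) ≤ 0`, that is, `-π/2 < ψ ≤ α
-- - π/2` up to an endpoint: an arc of length `α`.
open Real in
theorem planeGaussian_wedge {α : ℝ} (h0 : 0 ≤ α) (hπ : α ≤ π) :
    planeGaussian.real {z | 0 < z.1 ∧ z.1 * cos α + z.2 * sin α ≤ 0} = (2 * π)⁻¹ * α := by
  have hm : MeasurableSet {z : ℝ × ℝ | 0 < z.1 ∧ z.1 * cos α + z.2 * sin α ≤ 0} :=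
    (measurableSet_lt measurable_const measurable_fst).inter
      (measurableSet_le (f := fun z : ℝ × ℝ => z.1 * cos α + z.2 * sin α) (by fun_prop)
        measurable_const)
  have hpi := pi_pos
  rw [planeGaussian_cone hm (W := Set.Ioo (-(π / 2)) (π / 2) ∩ Set.Iic (α - π / 2))
    (measurableSet_Ioo.inter measurableSet_Iic)]
  · congr 1
    have h1 : (Set.Ioo (-(π / 2)) (π / 2) ∩ Set.Iic (α - π / 2)) ∩ Set.Ioo (-π) π =
        Set.Ioo (-(π / 2)) (π / 2) ∩ Set.Iic (α - π / 2) := by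
      apply Set.inter_eq_left.2
      rintro x ⟨⟨h1, h2⟩, -⟩
      constructor <;> linarith
    have h2 : (Set.Ioo (-(π / 2)) (π / 2) ∩ Set.Iic (α - π / 2) : Set ℝ) =ᵐ[volume]
        Set.Ioc (-(π / 2)) (α - π / 2) := by
      have h3 : Set.Ioc (-(π / 2)) (α - π / 2) =
          Set.Ioc (-(π / 2)) (π / 2) ∩ Set.Iic (α - π / 2) := by
        ext x
        simp only [Set.mem_Ioc, Set.mem_inter_iff, Set.mem_Iic]
        constructor
        · rintro ⟨h1, h2⟩; exact ⟨⟨h1, by linarith⟩, h2⟩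
        · rintro ⟨⟨h1, -⟩, h2⟩; exact ⟨h1, h2⟩
      rw [h3]
      exact Ioo_ae_eq_Ioc.inter (ae_eq_refl _)
    rw [h1, measureReal_congr h2, Real.volume_real_Ioc_of_le (by linarith)]
    ring
  · rintro r ψ hr ⟨hψ1, hψ2⟩
    have e : r * cos ψ * cos α + r * sin ψ * sin α = r * cos (ψ - α) := by
      rw [Real.cos_sub]; ring
    simp only [Set.mem_ofPred_eq, e, Set.mem_inter_iff, Set.mem_Ioo, Set.mem_Iic]
    rw [mul_pos_iff_of_pos_left hr]
    have hneg : r * cos (ψ - α) ≤ 0 ↔ cos (ψ - α) ≤ 0 := by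
      rw [← not_lt, ← not_lt, mul_pos_iff_of_pos_left hr]
    rw [hneg]
    have hcos : 0 < cos ψ ↔ -(π / 2) < ψ ∧ ψ < π / 2 := by
      refine ⟨fun h => ?_, fun h => Real.cos_pos_of_mem_Ioo ⟨h.1, h.2⟩⟩
      by_contra hne
      have h5 : cos |ψ| ≤ 0 := by
        apply Real.cos_nonpos_of_pi_div_two_le_of_le
        · rw [le_abs]
          by_contra h6
          push Not at h6
          exact hne ⟨by linarith, h6.1⟩
        · rw [abs_le]; constructor <;> linarith
      rw [Real.cos_abs] at h5
      linarith
    rw [hcos]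
    refine and_congr_right fun hψ => ⟨fun h => ?_, fun h => ?_⟩
    · by_contra hgt
      push Not at hgt
      exact absurd (Real.cos_pos_of_mem_Ioo ⟨by linarith, by linarith⟩) (not_lt.2 h)
    · rw [← Real.cos_neg]
      exact Real.cos_nonpos_of_pi_div_two_le_of_le (by linarith) (by linarith)

/-- The joint law of two linear functionals of a standard Gaussian vector. -/
theorem stdGaussian_map_inner_pair {d : ℕ} (u v : Vec d) {a b c : ℝ} (h1 : ‖u‖ ^ 2 = a ^ 2)
    (h2 : inner ℝ u v = a * b) (h3 : ‖v‖ ^ 2 = b ^ 2 + c ^ 2) :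
    (stdGaussian (Vec d)).map (fun θ => (inner ℝ θ u, inner ℝ θ v)) =
      planeGaussian.map (fun z => (a * z.1, b * z.1 + c * z.2)) := by
  have m1 : Measurable fun θ : Vec d => ((inner ℝ θ u : ℝ), (inner ℝ θ v : ℝ)) := by fun_prop
  have m2 : Measurable fun z : ℝ × ℝ => (a * z.1, b * z.1 + c * z.2) := by fun_prop
  have := Measure.isProbabilityMeasure_map (μ := stdGaussian (Vec d)) m1.aemeasurable
  have := Measure.isProbabilityMeasure_map (μ := planeGaussian) m2.aemeasurable
  -- Both laws are centred Gaussian, so it is enough to compare the variances of linear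
  -- combinations. The hypotheses state the triangular factorization of the Gram matrix of `u, v`
  -- with rows `(a, 0)` and `(b, c)`.
  apply Measure.ext_of_charFunDual
  ext L
  have hL : ∀ p : ℝ × ℝ, L p = p.1 * L (1, 0) + p.2 * L (0, 1) := by
    intro p
    have : p = p.1 • ((1 : ℝ), (0 : ℝ)) + p.2 • ((0 : ℝ), (1 : ℝ)) := by ext <;> simp
    conv_lhs => rw [this]
    rw [map_add, map_smul, map_smul, smul_eq_mul, smul_eq_mul]
  set s := L (1, 0)
  set t := L (0, 1)
  rw [charFunDual_apply, charFunDual_apply, integral_map m1.aemeasurable (by fun_prop),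
    integral_map m2.aemeasurable (by fun_prop)]
  have e1 : ∀ θ : Vec d, L (inner ℝ θ u, inner ℝ θ v) = inner ℝ θ (s • u + t • v) := by
    intro θ
    rw [hL, inner_add_right, inner_smul_right, inner_smul_right]; ring
  have e2 : ∀ z : ℝ × ℝ, Complex.exp (↑(L (a * z.1, b * z.1 + c * z.2)) * Complex.I) =
      Complex.exp (↑(inner ℝ z.1 (s * a + t * b)) * Complex.I) *
        Complex.exp (↑(inner ℝ z.2 (t * c)) * Complex.I) := by
    intro z
    rw [hL, ← Complex.exp_add, ← add_mul, ← Complex.ofReal_add]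
    congr 3
    simp only [RCLike.inner_apply, conj_trivial]
    ring
  simp_rw [e1, e2]
  rw [← charFun_apply, charFun_stdGaussian,
    integral_prod_mul (fun x : ℝ => Complex.exp (↑(inner ℝ x (s * a + t * b)) * Complex.I))
      (fun y : ℝ => Complex.exp (↑(inner ℝ y (t * c)) * Complex.I)),
    ← charFun_apply, ← charFun_apply, charFun_gaussianReal, charFun_gaussianReal,
    ← Complex.exp_add]
  congr 1
  have hn : ‖s • u + t • v‖ ^ 2 = (s * a + t * b) ^ 2 + (t * c) ^ 2 := by
    rw [norm_add_sq_real, norm_smul, norm_smul, inner_smul_left, inner_smul_right, h2, mul_pow,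
      mul_pow, h1, h3, Real.norm_eq_abs, Real.norm_eq_abs, sq_abs, sq_abs]
    simp only [conj_trivial]
    ring
  have hn' := congrArg (Complex.ofReal) hn
  push_cast at hn' ⊢
  rw [hn']
  ring

/-- Sheppard's formula: the probability that a random half-space separates two directions. -/
theorem stdGaussian_wedge_eq_Arc {d : ℕ} {u v : Vec d} (hu : u ≠ 0) (hv : v ≠ 0) :
    (stdGaussian (Vec d)).real {θ | 0 < (inner ℝ θ u : ℝ) ∧ (inner ℝ θ v : ℝ) ≤ 0} = Arc u v := by
  have hu' : 0 < ‖u‖ := norm_pos_iff.2 hu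
  have hv' : 0 < ‖v‖ := norm_pos_iff.2 hv
  set α := Real.arccos (inner ℝ u v / (‖u‖ * ‖v‖)) with hα
  have hcos : ‖v‖ * Real.cos α = inner ℝ u v / ‖u‖ := by
    have := abs_le.1 (abs_real_inner_div_norm_mul_norm_le_one u v)
    rw [hα, Real.cos_arccos this.1 this.2]
    field_simp
  -- In the plane of `u` and `v`, with first axis along `u`, the vector `v` has coordinates `‖v‖
  -- (cos α, sin α)`.
  have hlaw := stdGaussian_map_inner_pair u v (a := ‖u‖) (b := ‖v‖ * Real.cos α)
    (c := ‖v‖ * Real.sin α) rfl (by rw [hcos]; field_simp)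
    (by linear_combination -‖v‖ ^ 2 * Real.sin_sq_add_cos_sq α)
  have hm : MeasurableSet {p : ℝ × ℝ | 0 < p.1 ∧ p.2 ≤ 0} :=
    (measurableSet_lt measurable_const measurable_fst).inter
      (measurableSet_le measurable_snd measurable_const)
  have h1 := congrArg (fun μ : Measure (ℝ × ℝ) => μ.real {p : ℝ × ℝ | 0 < p.1 ∧ p.2 ≤ 0}) hlaw
  simp only at h1
  rw [map_measureReal_apply (by fun_prop) hm, map_measureReal_apply (by fun_prop) hm] at h1
  refine h1.trans ?_
  have h2 : (fun z : ℝ × ℝ => (‖u‖ * z.1, ‖v‖ * Real.cos α * z.1 + ‖v‖ * Real.sin α * z.2)) ⁻¹'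
      {p : ℝ × ℝ | 0 < p.1 ∧ p.2 ≤ 0} =
      {z | 0 < z.1 ∧ z.1 * Real.cos α + z.2 * Real.sin α ≤ 0} := by
    ext z
    have e : ‖v‖ * Real.cos α * z.1 + ‖v‖ * Real.sin α * z.2 =
        ‖v‖ * (z.1 * Real.cos α + z.2 * Real.sin α) := by ring
    simp only [Set.mem_preimage, Set.mem_ofPred_eq, e]
    rw [mul_pos_iff_of_pos_left hu', ← not_lt, ← not_lt, mul_pos_iff_of_pos_left hv']
  rw [h2, planeGaussian_wedge (Real.arccos_nonneg _) (Real.arccos_le_pi _), Arc, if_pos ⟨hu, hv⟩]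

/-- The first absolute moment of the standard Gaussian law. -/
noncomputable def gaussianAbsMoment : ℝ := ∫ x, |x| ∂(gaussianReal 0 1)

theorem gaussianAbsMoment_pos : 0 < gaussianAbsMoment := by
  have hi : Integrable (fun x : ℝ => |x|) (gaussianReal 0 1) :=
    (IsGaussian.integrable_id (μ := gaussianReal 0 1)).abs
  rw [gaussianAbsMoment, integral_pos_iff_support_of_nonneg (fun _ => abs_nonneg _) hi]
  have h1 : Function.support (fun x : ℝ => |x|) = {0}ᶜ := by ext; simp
  rw [h1]
  have h2 : (gaussianReal 0 1) {(0 : ℝ)} = 0 := by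
    have := nullSingletonClass_gaussianReal (μ := 0) (v := 1) one_ne_zero
    exact measure_singleton 0
  rw [prob_compl_eq_one_sub (measurableSet_singleton 0), h2]
  simp

theorem integral_abs_inner_stdGaussian {d : ℕ} (x : Vec d) :
    ∫ θ, |(inner ℝ θ x : ℝ)| ∂(stdGaussian (Vec d)) = gaussianAbsMoment * ‖x‖ := by
  have hlaw := stdGaussian_map_inner_pair x (0 : Vec d) (a := ‖x‖) (b := 0) (c := 0) rfl
    (by simp) (by simp)
  have h1 := congrArg (fun μ : Measure (ℝ × ℝ) => ∫ p, |p.1| ∂μ) hlaw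
  simp only at h1
  rw [integral_map (by fun_prop) (by fun_prop), integral_map (by fun_prop) (by fun_prop)] at h1
  rw [h1]
  simp_rw [abs_mul, abs_norm]
  rw [integral_const_mul, gaussianAbsMoment, mul_comm]
  congr 1
  simpa using integral_fun_fst (μ := gaussianReal 0 1) (ν := gaussianReal 0 1) fun x : ℝ => |x|

theorem integrable_abs_inner_stdGaussian {d : ℕ} (x : Vec d) :
    Integrable (fun θ => |(inner ℝ θ x : ℝ)|) (stdGaussian (Vec d)) :=
  ((IsGaussian.integrable_id (μ := stdGaussian (Vec d))).inner_const x).abs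

/-- This upgrades an almost sure identity between continuous functions of the direction to an
identity everywhere. -/
instance isOpenPosMeasure_stdGaussian (d : ℕ) : (stdGaussian (Vec d)).IsOpenPosMeasure := by
  have : (gaussianReal 0 1).IsOpenPosMeasure :=
    (gaussianReal_absolutelyContinuous' 0 one_ne_zero).isOpenPosMeasure
  rw [← map_pi_eq_stdGaussian]
  exact (PiLp.continuous_toLp 2 _).isOpenPosMeasure_map
    (WithLp.toLp_surjective 2)

/-- The inner product with a fixed nonzero vector is a nondegenerate normal variable, which has no
atom at zero. -/
theorem ae_ne_zero_stdGaussian {d : ℕ} (hd : d ≠ 0) : ∀ᵐ θ ∂(stdGaussian (Vec d)), θ ≠ 0 := by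
  have : Nonempty (Fin d) := ⟨⟨0, Nat.pos_of_ne_zero hd⟩⟩
  obtain ⟨x, hx⟩ := exists_ne (0 : Vec d)
  have h := stdGaussian_wedge_eq_Arc hx (v := x) hx
  have hlaw := stdGaussian_map_inner_pair x (0 : Vec d) (a := ‖x‖) (b := 0) (c := 0) rfl
    (by simp) (by simp)
  have hm : MeasurableSet {p : ℝ × ℝ | p.1 = 0} := measurableSet_eq_fun (by fun_prop) (by fun_prop)
  have h1 := congrArg (fun μ : Measure (ℝ × ℝ) => μ {p : ℝ × ℝ | p.1 = 0}) hlaw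
  simp only at h1
  rw [Measure.map_apply (by fun_prop) hm, Measure.map_apply (by fun_prop) hm] at h1
  have h2 : (fun z : ℝ × ℝ => (‖x‖ * z.1, 0 * z.1 + 0 * z.2)) ⁻¹' {p : ℝ × ℝ | p.1 = 0} =
      {0} ×ˢ Set.univ := by
    ext z; simp [hx]
  have h3 : (gaussianReal 0 1) {(0 : ℝ)} = 0 := by
    have := nullSingletonClass_gaussianReal (μ := 0) (v := 1) one_ne_zero
    exact measure_singleton 0
  rw [h2, Measure.prod_prod, h3, zero_mul] at h1
  rw [ae_iff]
  refine measure_mono_null (fun θ hθ => ?_) h1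
  simp only [ne_eq, not_not, Set.mem_ofPred_eq] at hθ
  simp [hθ]

/-! ### Five-point identities for the sign covariance -/

/-- Representatives of the cosets of the dihedral symmetry group of `alt` in the symmetric group on
five letters. -/
def cosetRep : Fin 15 → Fin 5 → Fin 5 :=
  ![![1, 2, 3, 4, 0], ![1, 2, 4, 3, 0], ![1, 3, 4, 2, 0], ![0, 2, 3, 4, 1], ![0, 2, 4, 3, 1],
    ![0, 3, 4, 2, 1], ![0, 1, 3, 4, 2], ![0, 1, 4, 3, 2], ![0, 3, 4, 1, 2], ![0, 1, 2, 4, 3],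
    ![0, 1, 4, 2, 3], ![0, 2, 4, 1, 3], ![0, 1, 2, 3, 4], ![0, 1, 3, 2, 4], ![0, 2, 3, 1, 4]]

/-- The symmetries of `alt`, up to sign, as permutations of the first four of five letters. -/
def altSymm : Fin 8 → Fin 5 → Fin 5 :=
  ![![0, 1, 2, 3, 4], ![3, 1, 2, 0, 4], ![0, 2, 1, 3, 4], ![3, 2, 1, 0, 4],
    ![1, 0, 3, 2, 4], ![2, 0, 3, 1, 4], ![1, 3, 0, 2, 4], ![2, 3, 0, 1, 4]]

/-- The sign by which `altSymm` acts on `alt`. -/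
def altSign : Fin 8 → ℝ := ![1, -1, -1, 1, 1, -1, -1, 1]

theorem cosetRep_injective : ∀ k, Function.Injective (cosetRep k) := by decide +kernel

theorem altSymm_injective : ∀ k, Function.Injective (altSymm k) := by decide +kernel

/-- The values at four letters determine a permutation of five. Injectivity of `(k, l) ↦ cosetRep k
∘ altSymm l` makes it a bijection, because `15 · 8 = 5!`. -/
theorem cosetRep_comp_altSymm_injective :
    ∀ k k' : Fin 15, cosetRep k 4 = cosetRep k' 4 → ∀ l l' : Fin 8,
      cosetRep k (altSymm l 0) = cosetRep k' (altSymm l' 0) →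
      cosetRep k (altSymm l 1) = cosetRep k' (altSymm l' 1) →
      cosetRep k (altSymm l 2) = cosetRep k' (altSymm l' 2) → k = k' ∧ l = l' := by
  decide +kernel

theorem sum_perm_eq_sum_cosetRep (φ : (Fin 5 → Fin 5) → ℝ) :
    ∑ σ : Equiv.Perm (Fin 5), φ σ = ∑ k, ∑ l, φ (fun i => cosetRep k (altSymm l i)) := by
  let e : Fin 15 × Fin 8 → Equiv.Perm (Fin 5) := fun p =>
    Equiv.ofBijective (fun i => cosetRep p.1 (altSymm p.2 i))
      (Finite.injective_iff_bijective.1 ((cosetRep_injective p.1).comp (altSymm_injective p.2)))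
  have he : Function.Bijective e := by
    rw [Fintype.bijective_iff_injective_and_card]
    refine ⟨fun p q hpq => ?_, ?_⟩
    · have h : ∀ i, cosetRep p.1 (altSymm p.2 i) = cosetRep q.1 (altSymm q.2 i) := fun i =>
        congrArg (fun σ : Equiv.Perm (Fin 5) => σ i) hpq
      have h4 : ∀ l, altSymm l 4 = 4 := by decide
      have h5 := h 4
      rw [h4, h4] at h5
      have h6 := cosetRep_comp_altSymm_injective _ _ h5 _ _ (h 0) (h 1) (h 2)
      exact Prod.ext h6.1 h6.2
    · simp [Fintype.card_perm, Nat.factorial]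
  rw [← Fintype.sum_prod_type', ← Fintype.sum_bijective e he _ _ fun p => rfl]
  rfl

/-- Integer form of the indicator `x ≤ t`, for ranks. -/
def rankThr (t x : Fin 5) : ℤ := if x ≤ t then 1 else 0

/-- Integer form of `alt`. -/
def rankAlt (a b c d : ℤ) : ℤ := (a - d) * (b - c)

/-- The alternating product at the threshold `t`, for ranks. -/
def rankAltThr (t a b c d : Fin 5) : ℤ :=
  rankAlt (rankThr t a) (rankThr t b) (rankThr t c) (rankThr t d)

/-- The sign covariance kernel for ranks. -/
def rankTau (a b c d : Fin 5) : ℤ :=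
  rankAltThr a a b c d + rankAltThr b a b c d + rankAltThr c a b c d + rankAltThr d a b c d

/-- The difference between the sides of the five-point identity for the sign covariance, for ranks. -/
def rankDefect (x y : Fin 5 → Fin 5) : ℤ :=
  rankTau (x 0) (x 1) (x 2) (x 3) * rankTau (y 0) (y 1) (y 2) (y 3) -
    3 * (rankAltThr (x 4) (x 0) (x 1) (x 2) (x 3) * rankAltThr (y 4) (y 0) (y 1) (y 2) (y 3)) -
    2 * (rankTau (x 0) (x 1) (x 2) (x 3) * rankAltThr (y 4) (y 0) (y 1) (y 2) (y 3))

/-- After sorting by the first coordinate, the rank of a point in that coordinate is its index. Only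
the relative order of the second coordinate, a permutation of `Fin 5`, is left to enumerate. -/
theorem sum_rankDefect_aux : ∀ y0 y1 y2 y3 y4 : Fin 5, [y0, y1, y2, y3, y4].Nodup →
    ∑ k, rankDefect (cosetRep k) (fun i => ![y0, y1, y2, y3, y4] (cosetRep k i)) = 0 := by
  decide +kernel

/-- Here the second coordinate is replaced by zero-one labels attached to the ranks, which model the
indicators `y ≤ t` for an external threshold `t`. -/
theorem rank_tau_mul_alt_aux : ∀ g0 g1 g2 g3 g4 : Fin 2,
    ∑ k, (fun (x : Fin 5 → Fin 5) (g : Fin 5 → ℤ) =>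
      (rankTau (x 0) (x 1) (x 2) (x 3) - 3 * rankAltThr (x 4) (x 0) (x 1) (x 2) (x 3)) *
        rankAlt (g (x 0)) (g (x 1)) (g (x 2)) (g (x 3)))
      (cosetRep k) ![g0, g1, g2, g3, g4] = 0 := by
  decide +kernel

/-- The indicator of `x ≤ t`. -/
noncomputable def thr (t x : ℝ) : ℝ := if x ≤ t then 1 else 0

theorem abs_thr_le (t x : ℝ) : |thr t x| ≤ 1 := by
  unfold thr; split_ifs <;> simp

@[fun_prop]
theorem Measurable.thr {α : Type*} [MeasurableSpace α] {f g : α → ℝ} (hf : Measurable f)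
    (hg : Measurable g) : Measurable fun x => thr (f x) (g x) :=
  Measurable.ite (measurableSet_le hg hf) measurable_const measurable_const

/-- The sign covariance kernel of Bergsma and Dassios. -/
noncomputable def tauKer (u : Fin 4 → ℝ) : ℝ := ∑ i, alt fun j => thr (u i) (u j)

@[fun_prop]
theorem measurable_tauKer : Measurable tauKer := by
  unfold tauKer; fun_prop

theorem abs_tauKer_le (u : Fin 4 → ℝ) : |tauKer u| ≤ 16 := by
  refine (Finset.abs_sum_le_sum_abs _ _).trans ?_
  refine (Finset.sum_le_sum fun i _ => abs_alt_le fun j => abs_thr_le (u i) (u j)).trans ?_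
  norm_num

/-- The first four of five entries. -/
def firstFour {α : Type*} (x : Fin 5 → α) : Fin 4 → α := fun i => x i.castSucc

theorem alt_firstFour_altSymm (x : Fin 5 → ℝ) (l : Fin 8) :
    alt (firstFour fun i => x (altSymm l i)) = altSign l * alt (firstFour x) := by
  fin_cases l <;> simp [alt, firstFour, altSymm, altSign, Fin.castSucc] <;> ring

theorem altSign_mul_self (l : Fin 8) : altSign l * altSign l = 1 := by
  fin_cases l <;> simp [altSign]

theorem altSymm_four (l : Fin 8) : altSymm l 4 = 4 := by revert l; decide

theorem tauKer_firstFour_altSymm (x : Fin 5 → ℝ) (l : Fin 8) :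
    tauKer (firstFour fun i => x (altSymm l i)) = altSign l * tauKer (firstFour x) := by
  have h : ∀ t, alt (fun j => thr t (x (altSymm l (Fin.castSucc j)))) =
      altSign l * alt fun j => thr t (x (Fin.castSucc j)) := fun t =>
    alt_firstFour_altSymm (fun i => thr t (x i)) l
  simp only [tauKer, firstFour, h, ← Finset.mul_sum]
  congr 1
  fin_cases l <;> simp [Fin.sum_univ_four, altSymm, Fin.castSucc] <;> ring

/-- The difference between the sides of the five-point identity for the sign covariance. -/
noncomputable def tauDefect (x y : Fin 5 → ℝ) : ℝ :=
  tauKer (firstFour x) * tauKer (firstFour y) -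
    3 * (alt (fun j => thr (x 4) (firstFour x j)) * alt fun j => thr (y 4) (firstFour y j)) -
    2 * (tauKer (firstFour x) * alt fun j => thr (y 4) (firstFour y j))

/-- The difference between the sides of the five-point identity with labels. -/
noncomputable def labelDefect (x g : Fin 5 → ℝ) : ℝ :=
  (tauKer (firstFour x) - 3 * alt fun j => thr (x 4) (firstFour x j)) * alt (firstFour g)

/-- Every term is a product of two factors that change by the same sign, so the sign cancels. The
sum over all permutations thus reduces to eight times the sum over the coset representatives. -/
theorem tauDefect_altSymm (x y : Fin 5 → ℝ) (l : Fin 8) :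
    (tauDefect (fun i => x (altSymm l i)) fun i => y (altSymm l i)) = tauDefect x y := by
  have h : ∀ t x, alt (fun j => thr t (firstFour (fun i => x (altSymm l i)) j)) =
      altSign l * alt fun j => thr t (firstFour x j) := fun t x =>
    alt_firstFour_altSymm (fun i => thr t (x i)) l
  simp only [tauDefect, tauKer_firstFour_altSymm, altSymm_four, h]
  linear_combination (tauKer (firstFour x) * tauKer (firstFour y) -
    3 * (alt (fun j => thr (x 4) (firstFour x j)) * alt fun j => thr (y 4) (firstFour y j)) -
    2 * (tauKer (firstFour x) * alt fun j => thr (y 4) (firstFour y j))) * altSign_mul_self l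

theorem labelDefect_altSymm (x g : Fin 5 → ℝ) (l : Fin 8) :
    (labelDefect (fun i => x (altSymm l i)) fun i => g (altSymm l i)) = labelDefect x g := by
  have h : ∀ t x, alt (fun j => thr t (firstFour (fun i => x (altSymm l i)) j)) =
      altSign l * alt fun j => thr t (firstFour x j) := fun t x =>
    alt_firstFour_altSymm (fun i => thr t (x i)) l
  simp only [labelDefect, tauKer_firstFour_altSymm, altSymm_four, h, alt_firstFour_altSymm]
  linear_combination ((tauKer (firstFour x) - 3 * alt fun j => thr (x 4) (firstFour x j)) *
    alt (firstFour g)) * altSign_mul_self l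

theorem thr_eq_rankThr {ι : Type*} {x : ι → ℝ} {r : ι → Fin 5}
    (hx : ∀ i j, x i ≤ x j ↔ r i ≤ r j) (i j : ι) : thr (x i) (x j) = (rankThr (r i) (r j) : ℝ) := by
  unfold thr rankThr
  by_cases h : x j ≤ x i
  · rw [if_pos h, if_pos ((hx j i).1 h)]; simp
  · rw [if_neg h, if_neg fun h' => h ((hx j i).2 h')]; simp

theorem alt_thr_eq_rankAltThr {x : Fin 5 → ℝ} {r : Fin 5 → Fin 5}
    (hx : ∀ i j, x i ≤ x j ↔ r i ≤ r j) (i : Fin 5) :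
    alt (fun j => thr (x i) (firstFour x j)) = (rankAltThr (r i) (r 0) (r 1) (r 2) (r 3) : ℝ) := by
  simp only [alt, firstFour, thr_eq_rankThr hx, rankAltThr, rankAlt]
  push_cast
  rfl

theorem tauKer_eq_rankTau {x : Fin 5 → ℝ} {r : Fin 5 → Fin 5}
    (hx : ∀ i j, x i ≤ x j ↔ r i ≤ r j) :
    tauKer (firstFour x) = (rankTau (r 0) (r 1) (r 2) (r 3) : ℝ) := by
  have h : ∀ i : Fin 4, (alt fun j => thr (firstFour x i) (firstFour x j)) =
      (rankAltThr (r i.castSucc) (r 0) (r 1) (r 2) (r 3) : ℝ) := fun i =>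
    alt_thr_eq_rankAltThr hx i.castSucc
  simp only [tauKer, h, Fin.sum_univ_four, rankTau]
  push_cast
  rfl

theorem tauDefect_eq_rankDefect {x y : Fin 5 → ℝ} {r s : Fin 5 → Fin 5}
    (hx : ∀ i j, x i ≤ x j ↔ r i ≤ r j) (hy : ∀ i j, y i ≤ y j ↔ s i ≤ s j) :
    tauDefect x y = (rankDefect r s : ℝ) := by
  simp only [tauDefect, rankDefect, alt_thr_eq_rankAltThr hx, alt_thr_eq_rankAltThr hy,
    tauKer_eq_rankTau hx, tauKer_eq_rankTau hy]
  push_cast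
  rfl

theorem exists_perm_le_iff {n : ℕ} {x : Fin n → ℝ} (hx : Function.Injective x) :
    ∃ τ : Equiv.Perm (Fin n), ∀ i j, x (τ i) ≤ x (τ j) ↔ i ≤ j := by
  refine ⟨Tuple.sort x, fun i j => ?_⟩
  have h : StrictMono (x ∘ Tuple.sort x) :=
    (Tuple.monotone_sort x).strictMono_of_injective (hx.comp (Tuple.sort x).injective)
  exact h.le_iff_le

theorem sum_perm_comp {β : Type*} (φ : (Fin 5 → β) → ℝ) (x : Fin 5 → β)
    (τ : Equiv.Perm (Fin 5)) :
    ∑ σ : Equiv.Perm (Fin 5), φ (fun i => x (σ i)) =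
      ∑ σ : Equiv.Perm (Fin 5), φ (fun i => x (τ (σ i))) :=
  (Equiv.sum_comp (Equiv.mulLeft τ)
    (fun σ : Equiv.Perm (Fin 5) => φ fun i => x (σ i))).symm

theorem sum_perm_tauDefect {x y : Fin 5 → ℝ} (hx : Function.Injective x)
    (hy : Function.Injective y) :
    ∑ σ : Equiv.Perm (Fin 5), tauDefect (fun i => x (σ i)) (fun i => y (σ i)) = 0 := by
  -- Relabelling by `τ` sorts `x`, so its ranks become the indices. The permutation `ρ` sorts the
  -- relabelled `y`, whose ranks are therefore given by `ρ.symm`.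
  obtain ⟨τ, hτ⟩ := exists_perm_le_iff hx
  obtain ⟨ρ, hρ⟩ := exists_perm_le_iff (hy.comp τ.injective)
  have hρ' : ∀ i j, y (τ i) ≤ y (τ j) ↔ ρ.symm i ≤ ρ.symm j := fun i j => by
    simpa using hρ (ρ.symm i) (ρ.symm j)
  rw [sum_perm_comp (fun z : Fin 5 → ℝ × ℝ => tauDefect (fun i => (z i).1) fun i => (z i).2)
    (fun i => (x i, y i)) τ]
  rw [sum_perm_eq_sum_cosetRep
    (fun s => tauDefect (fun i => x (τ (s i))) fun i => y (τ (s i)))]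
  have h : ∀ k l, tauDefect (fun i => x (τ (cosetRep k (altSymm l i))))
      (fun i => y (τ (cosetRep k (altSymm l i)))) =
      (rankDefect (cosetRep k) (fun i => ρ.symm (cosetRep k i)) : ℝ) := fun k l =>
    (tauDefect_altSymm (fun i => x (τ (cosetRep k i))) (fun i => y (τ (cosetRep k i))) l).trans
      (tauDefect_eq_rankDefect (fun i j => hτ _ _) (fun i j => hρ' _ _))
  have hv : ![ρ.symm 0, ρ.symm 1, ρ.symm 2, ρ.symm 3, ρ.symm 4] = ρ.symm := by
    ext i; fin_cases i <;> rfl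
  have hz := sum_rankDefect_aux (ρ.symm 0) (ρ.symm 1) (ρ.symm 2) (ρ.symm 3) (ρ.symm 4) (by
    simp)
  rw [hv] at hz
  simp only [h, Finset.sum_const]
  rw [← Finset.smul_sum, ← Int.cast_sum, hz]
  simp

theorem sum_perm_labelDefect {x g : Fin 5 → ℝ} (hx : Function.Injective x)
    (hg : ∀ i, g i = 0 ∨ g i = 1) :
    ∑ σ : Equiv.Perm (Fin 5), labelDefect (fun i => x (σ i)) (fun i => g (σ i)) = 0 := by
  obtain ⟨τ, hτ⟩ := exists_perm_le_iff hx
  have hb : ∀ i, ∃ b : Fin 2, g (τ i) = ((b : ℤ) : ℝ) := fun i => by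
    rcases hg (τ i) with h | h
    · exact ⟨0, by simp [h]⟩
    · exact ⟨1, by simp [h]⟩
  choose b hb using hb
  rw [sum_perm_comp (fun z : Fin 5 → ℝ × ℝ => labelDefect (fun i => (z i).1) fun i => (z i).2)
    (fun i => (x i, g i)) τ]
  rw [sum_perm_eq_sum_cosetRep
    (fun s => labelDefect (fun i => x (τ (s i))) fun i => g (τ (s i)))]
  have hz := rank_tau_mul_alt_aux (b 0) (b 1) (b 2) (b 3) (b 4)
  have hv : (![(b 0 : ℤ), (b 1 : ℤ), (b 2 : ℤ), (b 3 : ℤ), (b 4 : ℤ)] : Fin 5 → ℤ) =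
      fun i => (b i : ℤ) := by
    ext i; fin_cases i <;> rfl
  rw [hv] at hz
  have h : ∀ k l, labelDefect (fun i => x (τ (cosetRep k (altSymm l i))))
      (fun i => g (τ (cosetRep k (altSymm l i)))) =
      (((rankTau (cosetRep k 0) (cosetRep k 1) (cosetRep k 2) (cosetRep k 3) -
        3 * rankAltThr (cosetRep k 4) (cosetRep k 0) (cosetRep k 1) (cosetRep k 2) (cosetRep k 3)) *
        rankAlt (b (cosetRep k 0)) (b (cosetRep k 1)) (b (cosetRep k 2)) (b (cosetRep k 3)) : ℤ) :
          ℝ) := fun k l => by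
    refine (labelDefect_altSymm (fun i => x (τ (cosetRep k i)))
      (fun i => g (τ (cosetRep k i))) l).trans ?_
    have hr : ∀ i j, x (τ (cosetRep k i)) ≤ x (τ (cosetRep k j)) ↔ cosetRep k i ≤ cosetRep k j :=
      fun i j => hτ _ _
    simp only [labelDefect]
    rw [tauKer_eq_rankTau (x := fun i => x (τ (cosetRep k i))) hr,
      alt_thr_eq_rankAltThr (x := fun i => x (τ (cosetRep k i))) hr]
    simp only [alt, firstFour, hb, rankAlt]
    push_cast
    rfl
  simp only [h, Finset.sum_const]
  rw [← Finset.smul_sum, ← Int.cast_sum, hz]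
  simp

/-! ### Hoeffding's criterion for independence -/

section Criterion

theorem measurable_covar {κ α : Type*} [MeasurableSpace κ] [MeasurableSpace α] (P : Measure α)
    [SFinite P] {h g : κ → α → ℝ} (hm : Measurable (Function.uncurry h))
    (gm : Measurable (Function.uncurry g)) : Measurable fun w => covar P (h w) (g w) := by
  have h1 : Measurable fun w => ∫ x, h w x ∂P :=
    (StronglyMeasurable.integral_prod_right hm.stronglyMeasurable).measurable
  have h2 : Measurable fun w => ∫ x, g w x ∂P :=
    (StronglyMeasurable.integral_prod_right gm.stronglyMeasurable).measurable
  have h3 : Measurable fun w => ∫ x, h w x * g w x ∂P :=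
    (StronglyMeasurable.integral_prod_right (f := fun w x => h w x * g w x)
      (hm.mul gm).stronglyMeasurable).measurable
  exact h3.sub (h1.mul h2)

theorem abs_covar_le {α : Type*} [MeasurableSpace α] (P : Measure α) [IsProbabilityMeasure P]
    {h g : α → ℝ} (hb : ∀ x, |h x| ≤ 1) (gb : ∀ x, |g x| ≤ 1) : |covar P h g| ≤ 2 := by
  have key : ∀ f : α → ℝ, (∀ x, |f x| ≤ 1) → |∫ x, f x ∂P| ≤ 1 := fun f hf => by
    simpa using norm_integral_le_of_norm_le_const (μ := P) (f := f) (C := 1) (ae_of_all _ hf)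
  have h1 := key _ hb
  have h2 := key _ gb
  have h3 := key (fun x => h x * g x) fun x => by
    rw [abs_mul]; exact mul_le_one₀ (hb x) (abs_nonneg _) (gb x)
  have h4 : |(∫ x, h x ∂P) * ∫ x, g x ∂P| ≤ 1 := by
    rw [abs_mul]; exact mul_le_one₀ h1 (abs_nonneg _) h2
  exact (abs_sub _ _).trans (by linarith)

theorem integrable_covar_sq {κ α : Type*} [MeasurableSpace κ] [MeasurableSpace α] (P : Measure α)
    [IsProbabilityMeasure P] {μ : Measure κ} [IsFiniteMeasure μ] {h g : κ → α → ℝ}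
    (hm : Measurable (Function.uncurry h)) (gm : Measurable (Function.uncurry g))
    (hb : ∀ w x, |h w x| ≤ 1) (gb : ∀ w x, |g w x| ≤ 1) :
    Integrable (fun w => 4 * covar P (h w) (g w) ^ 2) μ := by
  refine integrable_of_abs_le (C := 16) (((measurable_covar P hm gm).pow_const 2).const_mul 4)
    fun w => ?_
  have h1 := abs_covar_le P (hb w) (gb w)
  rw [abs_mul, abs_pow, abs_of_pos (by norm_num : (0 : ℝ) < 4)]
  nlinarith [abs_nonneg (covar P (h w) (g w))]

theorem covar_eq_zero_of_integral_eq_zero {κ α : Type*} [MeasurableSpace κ] [MeasurableSpace α]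
    (P : Measure α) [IsProbabilityMeasure P] {μ : Measure κ} [IsFiniteMeasure μ] {h g : κ → α → ℝ}
    (hm : Measurable (Function.uncurry h)) (gm : Measurable (Function.uncurry g))
    (hb : ∀ w x, |h w x| ≤ 1) (gb : ∀ w x, |g w x| ≤ 1)
    (h0 : ∫ w, 4 * covar P (h w) (g w) ^ 2 ∂μ = 0) : ∀ᵐ w ∂μ, covar P (h w) (g w) = 0 := by
  rw [integral_eq_zero_iff_of_nonneg (fun w => by positivity)
    (integrable_covar_sq P hm gm hb gb)] at h0
  filter_upwards [h0] with w hw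
  simpa using hw

open Classical in
/-- The indicator of `r u x`. -/
noncomputable def relInd {E : Type*} (r : E → E → Prop) (x u : E) : ℝ := if r u x then 1 else 0

theorem abs_relInd_le {E : Type*} (r : E → E → Prop) (x u : E) : |relInd r x u| ≤ 1 := by
  unfold relInd; split_ifs <;> simp

variable {E F : Type*} [MeasurableSpace E] [MeasurableSpace F]

theorem measurable_relInd {r : E → E → Prop} (hr : MeasurableSet {p : E × E | r p.1 p.2}) :
    Measurable fun p : E × E => relInd r p.1 p.2 :=
  Measurable.ite (hr.preimage measurable_swap) measurable_const measurable_const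

theorem thr_eq_relInd (t x : ℝ) : thr t x = relInd (· ≤ ·) t x := by
  unfold thr relInd; congr

theorem covar_relInd (P : Measure (E × F)) [IsProbabilityMeasure P] {r : E → E → Prop}
    {s : F → F → Prop} {x : E} {y : F} (hr : MeasurableSet {u | r u x})
    (hs : MeasurableSet {v | s v y}) :
    covar P (fun p => relInd r x p.1) (fun p => relInd s y p.2) =
      P.real {p | r p.1 x ∧ s p.2 y} - (P.fst.prod P.snd).real {p | r p.1 x ∧ s p.2 y} := by
  have h1 : (fun p : E × F => relInd r x p.1) = ({p : E × F | r p.1 x}).indicator 1 := by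
    ext p; by_cases h : r p.1 x <;> simp [relInd, h]
  have h2 : (fun p : E × F => relInd s y p.2) = ({p : E × F | s p.2 y}).indicator 1 := by
    ext p; by_cases h : s p.2 y <;> simp [relInd, h]
  have h3 : (fun p : E × F => relInd r x p.1 * relInd s y p.2) =
      ({p : E × F | r p.1 x ∧ s p.2 y}).indicator 1 := by
    ext p
    by_cases h : r p.1 x <;> by_cases h' : s p.2 y <;> simp [relInd, h, h']
  have m1 : MeasurableSet {p : E × F | r p.1 x} := hr.preimage measurable_fst
  have m2 : MeasurableSet {p : E × F | s p.2 y} := hs.preimage measurable_snd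
  have h4 : {p : E × F | r p.1 x ∧ s p.2 y} = {u | r u x} ×ˢ {v | s v y} := rfl
  rw [covar, h1, h2, h3, integral_indicator_one m1, integral_indicator_one m2,
    integral_indicator_one (show MeasurableSet {p : E × F | r p.1 x ∧ s p.2 y} from m1.inter m2), h4, measureReal_prod_prod,
    measureReal_def P.fst, measureReal_def P.snd, Measure.fst_apply hr, Measure.snd_apply hs]
  rfl

/-- Hoeffding's criterion: an absolutely continuous law is a product as soon as the covariances of
its orthant indicators vanish almost everywhere, either for the law or for the product of its
marginals. -/
theorem eq_prod_of_ae_covar_eq_zero {μ : Measure E} {ν : Measure F} [SigmaFinite μ] [SigmaFinite ν]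
    {r : E → E → Prop} {s : F → F → Prop} (hμ : HasZeroSetProperty μ r)
    (hν : HasZeroSetProperty ν s) {P : Measure (E × F)} [IsProbabilityMeasure P]
    (hP : P ≪ μ.prod ν)
    (h : (∀ᵐ p ∂P, covar P (fun q => relInd r p.1 q.1) (fun q => relInd s p.2 q.2) = 0) ∨
      ∀ᵐ p ∂(P.fst.prod P.snd), covar P (fun q => relInd r p.1 q.1)
        (fun q => relInd s p.2 q.2) = 0) :
    P = P.fst.prod P.snd := by
  have h1 : P.fst ≪ μ := hP.map measurable_fst |>.trans Measure.quasiMeasurePreserving_fst.2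
  have h2 : P.snd ≪ ν := hP.map measurable_snd |>.trans Measure.quasiMeasurePreserving_snd.2
  have hsl : ∀ y, MeasurableSet {v | s v y} := fun y =>
    hν.1.preimage (measurable_id.prodMk measurable_const)
  have hrl : ∀ y, MeasurableSet {v | r v y} := fun y =>
    hμ.1.preimage (measurable_id.prodMk measurable_const)
  have hP2 : P.fst.prod P.snd ≪ μ.prod ν := h1.prod h2
  rcases h with h | h
  · refine (hμ.prod hν).eq_of_ae_eq hP hP2 ?_
    filter_upwards [h] with p hp
    rw [covar_relInd P (hrl _) (hsl _)] at hp
    linarith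
  · refine ((hμ.prod hν).eq_of_ae_eq hP2 hP ?_).symm
    filter_upwards [h] with p hp
    rw [covar_relInd P (hrl _) (hsl _)] at hp
    linarith

end Criterion

/-! ### Bivariate laws -/

section Bivariate

theorem measure_fst_eq_zero_of_ac {Q : Measure (ℝ × ℝ)} (hQ : Q ≪ volume) (s : ℝ) : Q {p | p.1 = s} = 0 := by
  apply hQ
  have : {p : ℝ × ℝ | p.1 = s} = {s} ×ˢ Set.univ := by ext p; simp
  rw [this, Measure.volume_eq_prod, Measure.prod_prod]
  simp

variable (Q : Measure (ℝ × ℝ)) [IsProbabilityMeasure Q]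

/-- The difference between the joint distribution function and the product of the marginal ones. -/
noncomputable def cdfGap (s t : ℝ) : ℝ := covar Q (fun p => thr s p.1) fun p => thr t p.2

theorem measurable_cdfGap : Measurable fun p : ℝ × ℝ => cdfGap Q p.1 p.2 :=
  measurable_covar Q (h := fun (p : ℝ × ℝ) (q : ℝ × ℝ) => thr p.1 q.1)
    (g := fun (p : ℝ × ℝ) (q : ℝ × ℝ) => thr p.2 q.2)
    (by unfold Function.uncurry; fun_prop) (by unfold Function.uncurry; fun_prop)

variable {Q}

theorem eq_prod_of_ae_cdfGap_eq_zero (hQ : Q ≪ volume)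
    (h : (∀ᵐ p ∂Q, cdfGap Q p.1 p.2 = 0) ∨ ∀ᵐ p ∂(Q.fst.prod Q.snd), cdfGap Q p.1 p.2 = 0) :
    Q = Q.fst.prod Q.snd := by
  simp only [cdfGap, thr_eq_relInd] at h
  exact eq_prod_of_ae_covar_eq_zero hasZeroSetProperty_real hasZeroSetProperty_real hQ h

variable (Q)

/-- The fifth point supplies both thresholds, so the squared gap is integrated against the joint
law. -/
theorem integral_alt_thr_mul_alt_thr_five :
    ∫ z : Fin 5 → ℝ × ℝ, alt (fun j => thr (z 4).1 (z j.castSucc).1) *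
        alt (fun j => thr (z 4).2 (z j.castSucc).2) ∂(Measure.pi fun _ => Q) =
      ∫ w : Fin 1 → ℝ × ℝ, 4 * cdfGap Q (w 0).1 (w 0).2 ^ 2 ∂(Measure.pi fun _ => Q) :=
  integral_alt_mul_alt_param Q (κ := Fin 1) (m := 5)
    (e := Sum.elim (fun i : Fin 4 => i.castSucc) fun _ => 4) (by decide)
    (h := fun w p => thr (w 0).1 p.1) (g := fun w p => thr (w 0).2 p.2)
    (by unfold Function.uncurry; fun_prop) (by unfold Function.uncurry; fun_prop)
    (fun _ _ => abs_thr_le _ _) (fun _ _ => abs_thr_le _ _)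

/-- The two thresholds come from different points, so the squared gap is in effect integrated
against the product of the marginals. -/
theorem integral_alt_thr_mul_alt_thr_six :
    ∫ z : Fin 6 → ℝ × ℝ, alt (fun j => thr (z 4).1 (z (j.castAdd 2)).1) *
        alt (fun j => thr (z 5).2 (z (j.castAdd 2)).2) ∂(Measure.pi fun _ => Q) =
      ∫ w : Fin 2 → ℝ × ℝ, 4 * cdfGap Q (w 0).1 (w 1).2 ^ 2 ∂(Measure.pi fun _ => Q) :=
  integral_alt_mul_alt_param Q (κ := Fin 2) (m := 6)
    (e := Sum.elim (fun i : Fin 4 => i.castAdd 2) ![4, 5]) (by decide)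
    (h := fun w p => thr (w 0).1 p.1) (g := fun w p => thr (w 1).2 p.2)
    (by unfold Function.uncurry; fun_prop) (by unfold Function.uncurry; fun_prop)
    (fun _ _ => abs_thr_le _ _) (fun _ _ => abs_thr_le _ _)

variable {Q}

theorem eq_prod_of_integral_cdfGap_one (hQ : Q ≪ volume)
    (h : ∫ w : Fin 1 → ℝ × ℝ, 4 * cdfGap Q (w 0).1 (w 0).2 ^ 2 ∂(Measure.pi fun _ => Q) = 0) :
    Q = Q.fst.prod Q.snd := by
  have h1 := covar_eq_zero_of_integral_eq_zero Q
    (h := fun (w : Fin 1 → ℝ × ℝ) (p : ℝ × ℝ) => thr (w 0).1 p.1)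
    (g := fun (w : Fin 1 → ℝ × ℝ) (p : ℝ × ℝ) => thr (w 0).2 p.2)
    (by unfold Function.uncurry; fun_prop) (by unfold Function.uncurry; fun_prop)
    (fun _ _ => abs_thr_le _ _) (fun _ _ => abs_thr_le _ _) h
  refine eq_prod_of_ae_cdfGap_eq_zero hQ (Or.inl ?_)
  exact ((measurePreserving_funUnique Q (Fin 1)).symm _).quasiMeasurePreserving.ae h1

theorem eq_prod_of_integral_cdfGap_two (hQ : Q ≪ volume)
    (h : ∫ w : Fin 2 → ℝ × ℝ, 4 * cdfGap Q (w 0).1 (w 1).2 ^ 2 ∂(Measure.pi fun _ => Q) = 0) :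
    Q = Q.fst.prod Q.snd := by
  have h1 := covar_eq_zero_of_integral_eq_zero Q
    (h := fun (w : Fin 2 → ℝ × ℝ) (p : ℝ × ℝ) => thr (w 0).1 p.1)
    (g := fun (w : Fin 2 → ℝ × ℝ) (p : ℝ × ℝ) => thr (w 1).2 p.2)
    (by unfold Function.uncurry; fun_prop) (by unfold Function.uncurry; fun_prop)
    (fun _ _ => abs_thr_le _ _) (fun _ _ => abs_thr_le _ _) h
  refine eq_prod_of_ae_cdfGap_eq_zero hQ (Or.inr ?_)
  have mp : MeasurePreserving (fun w : Fin 2 → ℝ × ℝ => ((w 0).1, (w 1).2))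
      (Measure.pi fun _ => Q) (Q.fst.prod Q.snd) :=
    (MeasurePreserving.prod ⟨measurable_fst, rfl⟩ ⟨measurable_snd, rfl⟩).comp
      (measurePreserving_pi_pair Q (i := (0 : Fin 2)) (j := 1) (by simp))
  have hm : MeasurableSet {p : ℝ × ℝ | cdfGap Q p.1 p.2 = 0} :=
    measurable_cdfGap Q (measurableSet_singleton 0)
  rw [← mp.map_eq, ae_map_iff mp.measurable.aemeasurable hm]
  exact h1

/-- A statistic whose symmetrization vanishes has integral zero. -/
theorem integral_eq_zero_of_sum_perm_eq_zero {α : Type*} [MeasurableSpace α] (P : Measure α)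
    [IsProbabilityMeasure P] {n : ℕ} {f : (Fin n → α) → ℝ} (hf : Measurable f) {C : ℝ}
    (hC : ∀ z, |f z| ≤ C)
    (h : ∀ᵐ z ∂(Measure.pi fun _ => P), ∑ σ : Equiv.Perm (Fin n), f (fun i => z (σ i)) = 0) :
    ∫ z, f z ∂(Measure.pi fun _ => P) = 0 := by
  have hσ : ∀ σ : Equiv.Perm (Fin n), ∫ z, f (fun i => z (σ i)) ∂(Measure.pi fun _ => P) =
      ∫ z, f z ∂(Measure.pi fun _ => P) := fun σ => by
    have mp := measurePreserving_pi_comp P σ.injective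
    conv_rhs => rw [← mp.map_eq]
    rw [integral_map mp.measurable.aemeasurable hf.aestronglyMeasurable]
  have h1 := integral_congr_ae h
  have hi : ∀ σ : Equiv.Perm (Fin n),
      Integrable (fun z : Fin n → α => f fun i => z (σ i)) (Measure.pi fun _ => P) := fun σ =>
    integrable_of_abs_le (by fun_prop) fun z => hC _
  rw [integral_finsetSum _ fun σ _ => hi σ] at h1
  simp only [hσ, Finset.sum_const, integral_zero, Finset.card_univ, Fintype.card_perm,
    Fintype.card_fin, nsmul_eq_mul, mul_eq_zero, Nat.cast_eq_zero] at h1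
  exact h1.resolve_left (Nat.factorial_ne_zero n)

end Bivariate

/-! ### Expectation of the sign covariance kernel -/

section SignCovariance

theorem measure_snd_eq_zero_of_ac {Q : Measure (ℝ × ℝ)} (hQ : Q ≪ volume) (s : ℝ) :
    Q {p | p.2 = s} = 0 := by
  apply hQ
  have : {p : ℝ × ℝ | p.2 = s} = Set.univ ×ˢ {s} := by ext p; simp
  rw [this, Measure.volume_eq_prod, Measure.prod_prod]
  simp

theorem abs_mul_le_of_le {a b A B : ℝ} (ha : |a| ≤ A) (hb : |b| ≤ B) : |a * b| ≤ A * B := by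
  rw [abs_mul]
  exact mul_le_mul ha hb (abs_nonneg _) ((abs_nonneg _).trans ha)

variable {Q : Measure (ℝ × ℝ)} [IsProbabilityMeasure Q]

theorem integral_firstFour {f : (Fin 4 → ℝ × ℝ) → ℝ} (hf : Measurable f) :
    ∫ z : Fin 5 → ℝ × ℝ, f (fun i => z i.castSucc) ∂(Measure.pi fun _ => Q) =
      ∫ z, f z ∂(Measure.pi fun _ => Q) := by
  have mp := measurePreserving_pi_comp Q (Fin.castSucc_injective 4)
  conv_rhs => rw [← mp.map_eq]
  rw [integral_map mp.measurable.aemeasurable hf.aestronglyMeasurable]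

/-- The labelled five-point identity, with labels `thr t` of the second coordinates, allows the four
internal thresholds of `tauKer` to be replaced by three times a single external one, the first
coordinate of a fifth point. Ties in the labels are harmless. -/
theorem integral_tauKer_mul_alt_thr (hQ : Q ≪ volume) (t : ℝ) :
    ∫ z : Fin 4 → ℝ × ℝ, tauKer (fun i => (z i).1) * alt (fun i => thr t (z i).2)
        ∂(Measure.pi fun _ => Q) =
      3 * ∫ w : Fin 1 → ℝ × ℝ, 4 * cdfGap Q (w 0).1 t ^ 2 ∂(Measure.pi fun _ => Q) := by
  set f : (Fin 4 → ℝ × ℝ) → ℝ := fun z =>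
    tauKer (fun i => (z i).1) * alt (fun i => thr t (z i).2) with hf
  have hfm : Measurable f := by fun_prop
  have hfb : ∀ z, |f z| ≤ 16 * 4 := fun z =>
    abs_mul_le_of_le (abs_tauKer_le _) (abs_alt_le fun _ => abs_thr_le _ _)
  set g : (Fin 5 → ℝ × ℝ) → ℝ := fun z =>
    alt (fun i => thr (z 4).1 (z i.castSucc).1) * alt (fun i => thr t (z i.castSucc).2) with hg
  have hgm : Measurable g := by fun_prop
  have hgb : ∀ z, |g z| ≤ 4 * 4 := fun z =>
    abs_mul_le_of_le (abs_alt_le fun _ => abs_thr_le _ _) (abs_alt_le fun _ => abs_thr_le _ _)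
  have e1 : ∫ z, g z ∂(Measure.pi fun _ => Q) =
      ∫ w : Fin 1 → ℝ × ℝ, 4 * cdfGap Q (w 0).1 t ^ 2 ∂(Measure.pi fun _ => Q) :=
    integral_alt_mul_alt_param Q (κ := Fin 1) (m := 5)
      (e := Sum.elim (fun i : Fin 4 => i.castSucc) fun _ => 4) (by decide)
      (h := fun w p => thr (w 0).1 p.1) (g := fun w p => thr t p.2)
      (by unfold Function.uncurry; fun_prop) (by unfold Function.uncurry; fun_prop)
      (fun _ _ => abs_thr_le _ _) (fun _ _ => abs_thr_le _ _)
  have hfm' : Measurable fun z : Fin 5 → ℝ × ℝ => f fun i => z i.castSucc :=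
    hfm.comp (by fun_prop)
  have hz : ∫ z : Fin 5 → ℝ × ℝ, (f (fun i => z i.castSucc) - 3 * g z)
      ∂(Measure.pi fun _ => Q) = 0 := by
    refine integral_eq_zero_of_sum_perm_eq_zero Q (C := 16 * 4 + 3 * (4 * 4))
      (hfm'.sub (hgm.const_mul 3)) (fun z => ?_) ?_
    · refine (abs_sub _ _).trans (add_le_add (hfb _) ?_)
      rw [abs_mul, abs_of_pos (by norm_num : (0 : ℝ) < 3)]
      exact mul_le_mul_of_nonneg_left (hgb z) (by norm_num)
    · filter_upwards [ae_pi_injective Q measurable_fst (measure_fst_eq_zero_of_ac hQ)] with z hz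
      rw [← sum_perm_labelDefect hz (g := fun i => thr t (z i).2) fun i => by
        unfold thr; split_ifs <;> simp]
      refine Finset.sum_congr rfl fun σ _ => ?_
      simp only [hf, hg, labelDefect, sub_mul, mul_assoc]
      rfl
  rw [integral_sub (integrable_of_abs_le hfm' fun z => hfb _)
    ((integrable_of_abs_le hgm hgb).const_mul 3), integral_firstFour hfm, integral_const_mul,
    e1] at hz
  linarith

/-- Integrating the five-point identity leaves three times the term whose two thresholds come from
the fifth point, and twice a mixed term. Conditionally on the fifth point, the mixed term is
evaluated by `integral_tauKer_mul_alt_thr`. Both contributions are integrals of squares. -/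
theorem integral_tauKer_mul_tauKer (hQ : Q ≪ volume) :
    ∫ z : Fin 4 → ℝ × ℝ, tauKer (fun i => (z i).1) * tauKer (fun i => (z i).2)
        ∂(Measure.pi fun _ => Q) =
      3 * ∫ w : Fin 1 → ℝ × ℝ, 4 * cdfGap Q (w 0).1 (w 0).2 ^ 2 ∂(Measure.pi fun _ => Q) +
      2 * ∫ v : Fin 1 → ℝ × ℝ, 3 * ∫ w : Fin 1 → ℝ × ℝ, 4 * cdfGap Q (w 0).1 (v 0).2 ^ 2
        ∂(Measure.pi fun _ => Q) ∂(Measure.pi fun _ => Q) := by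
  set f : (Fin 4 → ℝ × ℝ) → ℝ := fun z =>
    tauKer (fun i => (z i).1) * tauKer (fun i => (z i).2) with hf
  have hfm : Measurable f := by fun_prop
  have hfb : ∀ z, |f z| ≤ 16 * 16 := fun z =>
    abs_mul_le_of_le (abs_tauKer_le _) (abs_tauKer_le _)
  set g : (Fin 5 → ℝ × ℝ) → ℝ := fun z =>
    alt (fun i => thr (z 4).1 (z i.castSucc).1) * alt (fun i => thr (z 4).2 (z i.castSucc).2)
    with hg
  have hgm : Measurable g := by fun_prop
  have hgb : ∀ z, |g z| ≤ 4 * 4 := fun z =>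
    abs_mul_le_of_le (abs_alt_le fun _ => abs_thr_le _ _) (abs_alt_le fun _ => abs_thr_le _ _)
  set k : (Fin 4 → ℝ × ℝ) × (Fin 1 → ℝ × ℝ) → ℝ := fun q =>
    tauKer (fun i => (q.1 i).1) * alt (fun i => thr (q.2 0).2 (q.1 i).2) with hk
  have hkm : Measurable k := by fun_prop
  have hkb : ∀ z, |k z| ≤ 16 * 4 := fun z =>
    abs_mul_le_of_le (abs_tauKer_le _) (abs_alt_le fun _ => abs_thr_le _ _)
  have mp := measurePreserving_pi_sum Q
    (e := (Sum.elim (fun i : Fin 4 => i.castSucc) fun _ : Fin 1 => (4 : Fin 5))) (by decide)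
  have e2 : ∫ z : Fin 5 → ℝ × ℝ, k (fun i => z i.castSucc, fun _ => z 4)
      ∂(Measure.pi fun _ => Q) = ∫ v : Fin 1 → ℝ × ℝ, 3 * ∫ w : Fin 1 → ℝ × ℝ,
        4 * cdfGap Q (w 0).1 (v 0).2 ^ 2 ∂(Measure.pi fun _ => Q) ∂(Measure.pi fun _ => Q) := by
    have hmap := integral_map (μ := Measure.pi fun _ : Fin 5 => Q) mp.measurable.aemeasurable
      (f := k) hkm.aestronglyMeasurable
    rw [mp.map_eq] at hmap
    refine hmap.symm.trans ?_
    rw [integral_prod_symm _ (integrable_of_abs_le hkm hkb)]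
    refine integral_congr_ae (ae_of_all _ fun v => ?_)
    exact integral_tauKer_mul_alt_thr hQ (v 0).2
  have hfm' : Measurable fun z : Fin 5 → ℝ × ℝ => f fun i => z i.castSucc :=
    hfm.comp (by fun_prop)
  have hkm' : Measurable fun z : Fin 5 → ℝ × ℝ => k (fun i => z i.castSucc, fun _ => z 4) :=
    hkm.comp (by fun_prop)
  have hz : ∫ z : Fin 5 → ℝ × ℝ, (f (fun i => z i.castSucc) - 3 * g z -
      2 * k (fun i => z i.castSucc, fun _ => z 4)) ∂(Measure.pi fun _ => Q) = 0 := by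
    refine integral_eq_zero_of_sum_perm_eq_zero Q (C := 16 * 16 + 3 * (4 * 4) + 2 * (16 * 4))
      ((hfm'.sub (hgm.const_mul 3)).sub (hkm'.const_mul 2)) (fun z => ?_) ?_
    · refine (abs_sub _ _).trans (add_le_add ((abs_sub _ _).trans (add_le_add (hfb _) ?_)) ?_)
      · rw [abs_mul, abs_of_pos (by norm_num : (0 : ℝ) < 3)]
        exact mul_le_mul_of_nonneg_left (hgb z) (by norm_num)
      · rw [abs_mul, abs_of_pos (by norm_num : (0 : ℝ) < 2)]
        exact mul_le_mul_of_nonneg_left (hkb _) (by norm_num)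
    · filter_upwards [ae_pi_injective Q measurable_fst (measure_fst_eq_zero_of_ac hQ),
        ae_pi_injective Q measurable_snd (measure_snd_eq_zero_of_ac hQ)] with z hz1 hz2
      rw [← sum_perm_tauDefect hz1 hz2]
      rfl
  have i1 := integrable_of_abs_le (μ := Measure.pi fun _ => Q) hfm' fun z => hfb _
  have i2 := (integrable_of_abs_le (μ := Measure.pi fun _ => Q) hgm hgb).const_mul 3
  have i3 := (integrable_of_abs_le (μ := Measure.pi fun _ => Q) hkm' fun z => hkb _).const_mul 2
  rw [integral_sub (f := fun z : Fin 5 → ℝ × ℝ => f (fun i => z i.castSucc) - 3 * g z)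
    (i1.sub i2) i3, integral_sub i1 i2, integral_firstFour hfm, integral_const_mul,
    integral_const_mul, e2, hg, integral_alt_thr_mul_alt_thr_five Q] at hz
  linarith

theorem integral_tauKer_mul_tauKer_nonneg (hQ : Q ≪ volume) :
    0 ≤ ∫ z : Fin 4 → ℝ × ℝ, tauKer (fun i => (z i).1) * tauKer (fun i => (z i).2)
        ∂(Measure.pi fun _ => Q) := by
  rw [integral_tauKer_mul_tauKer hQ]
  positivity

theorem eq_prod_of_integral_tauKer_eq_zero (hQ : Q ≪ volume)
    (h : ∫ z : Fin 4 → ℝ × ℝ, tauKer (fun i => (z i).1) * tauKer (fun i => (z i).2)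
        ∂(Measure.pi fun _ => Q) = 0) : Q = Q.fst.prod Q.snd := by
  rw [integral_tauKer_mul_tauKer hQ] at h
  refine eq_prod_of_integral_cdfGap_one hQ ?_
  have h1 : 0 ≤ ∫ w : Fin 1 → ℝ × ℝ, 4 * cdfGap Q (w 0).1 (w 0).2 ^ 2 ∂(Measure.pi fun _ => Q) := by
    positivity
  have h2 : 0 ≤ ∫ v : Fin 1 → ℝ × ℝ, 3 * ∫ w : Fin 1 → ℝ × ℝ, 4 * cdfGap Q (w 0).1 (v 0).2 ^ 2
        ∂(Measure.pi fun _ => Q) ∂(Measure.pi fun _ => Q) := by positivity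
  linarith

end SignCovariance

/-! ### The group `H_*^m` and its signed sums -/

section SignedSum

theorem mem_HStar_iff {m : ℕ} (hm : 4 ≤ m) (σ : Equiv.Perm (Fin m)) :
    σ ∈ HStar m hm ↔ σ = 1 ∨ σ = Equiv.swap ⟨0, by omega⟩ ⟨3, by omega⟩ ∨
      σ = Equiv.swap ⟨1, by omega⟩ ⟨2, by omega⟩ ∨
      σ = Equiv.swap ⟨0, by omega⟩ ⟨3, by omega⟩ * Equiv.swap ⟨1, by omega⟩ ⟨2, by omega⟩ := by
  set s : Equiv.Perm (Fin m) := Equiv.swap ⟨0, by omega⟩ ⟨3, by omega⟩ with hs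
  set t : Equiv.Perm (Fin m) := Equiv.swap ⟨1, by omega⟩ ⟨2, by omega⟩ with ht
  have hss : s * s = 1 := Equiv.swap_mul_self _ _
  have htt : t * t = 1 := Equiv.swap_mul_self _ _
  have hst : t * s = s * t := by
    refine (Equiv.Perm.Disjoint.commute ?_).eq
    intro i
    rw [hs, ht]
    by_cases h : i = ⟨0, by omega⟩ ∨ i = ⟨3, by omega⟩
    · left
      rcases h with h | h <;> subst h <;> exact Equiv.swap_apply_of_ne_of_ne (by simp) (by simp)
    · right
      push Not at h
      exact Equiv.swap_apply_of_ne_of_ne h.1 h.2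
  have hs' : s⁻¹ = s := inv_eq_of_mul_eq_one_left hss
  have ht' : t⁻¹ = t := inv_eq_of_mul_eq_one_left htt
  have hmem_s : s ∈ HStar m hm := Subgroup.subset_closure (Or.inl rfl)
  have hmem_t : t ∈ HStar m hm := Subgroup.subset_closure (Or.inr rfl)
  constructor
  · intro h
    -- Two commuting involutions generate at most a Klein four-group, so the four listed elements
    -- are already closed under the group operations.
    let K : Subgroup (Equiv.Perm (Fin m)) :=
      { carrier := {σ | σ = 1 ∨ σ = s ∨ σ = t ∨ σ = s * t}
        one_mem' := Or.inl rfl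
        mul_mem' := by
          have e1 : ∀ x, s * (s * x) = x := fun x => by rw [← mul_assoc, hss, one_mul]
          have e3 : ∀ x, t * (s * x) = s * (t * x) := fun x => by
            rw [← mul_assoc, hst, mul_assoc]
          rintro a b (rfl | rfl | rfl | rfl) (rfl | rfl | rfl | rfl) <;>
            simp [mul_assoc, e1, e3, hss, htt, hst]
        inv_mem' := by
          rintro a (rfl | rfl | rfl | rfl) <;> simp [hs', ht', hst] }
    have hK : HStar m hm ≤ K := by
      rw [HStar, Subgroup.closure_le]
      rintro a (rfl | rfl)
      · exact Or.inr (Or.inl rfl)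
      · exact Or.inr (Or.inr (Or.inl rfl))
    exact hK h
  · rintro (rfl | rfl | rfl | rfl)
    · exact one_mem _
    · exact hmem_s
    · exact hmem_t
    · exact mul_mem hmem_s hmem_t

theorem signedSum_HStar {d m : ℕ} (hm : 4 ≤ m) (f : (Fin m → Vec d) → ℝ) (w : Fin m → Vec d) :
    signedSum (HStar m hm) f w = f w - f (fun i => w (Equiv.swap ⟨0, by omega⟩ ⟨3, by omega⟩ i)) -
      f (fun i => w (Equiv.swap ⟨1, by omega⟩ ⟨2, by omega⟩ i)) +
      f (fun i => w ((Equiv.swap ⟨0, by omega⟩ ⟨3, by omega⟩ *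
        Equiv.swap ⟨1, by omega⟩ ⟨2, by omega⟩ : Equiv.Perm (Fin m)) i)) := by
  classical
  set s : Equiv.Perm (Fin m) := Equiv.swap ⟨0, by omega⟩ ⟨3, by omega⟩ with hs
  set t : Equiv.Perm (Fin m) := Equiv.swap ⟨1, by omega⟩ ⟨2, by omega⟩ with ht
  have hsgs : Equiv.Perm.sign s = -1 := Equiv.Perm.sign_swap (by simp)
  have hsgt : Equiv.Perm.sign t = -1 := Equiv.Perm.sign_swap (by simp)
  have h0 : s ⟨0, by omega⟩ = ⟨3, by omega⟩ := Equiv.swap_apply_left _ _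
  have h1 : t ⟨0, by omega⟩ = ⟨0, by omega⟩ :=
    Equiv.swap_apply_of_ne_of_ne (by simp) (by simp)
  have n1 : (1 : Equiv.Perm (Fin m)) ≠ s := fun h => by
    have := congrArg Equiv.Perm.sign h
    rw [hsgs] at this; simp at this
  have n2 : (1 : Equiv.Perm (Fin m)) ≠ t := fun h => by
    have := congrArg Equiv.Perm.sign h
    rw [hsgt] at this; simp at this
  have n4 : s ≠ t := fun h => by
    rw [h, h1] at h0
    simp at h0
  have n3 : (1 : Equiv.Perm (Fin m)) ≠ s * t := fun h => by
    apply n4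
    rw [eq_comm, mul_eq_one_iff_eq_inv] at h
    rw [h, ht, Equiv.swap_inv]
  have n5 : s ≠ s * t := fun h => n2 (by simpa [eq_comm] using h)
  have n6 : t ≠ s * t := fun h => n1 (by simpa [eq_comm] using h)
  have hfil : (Finset.univ.filter fun σ : Equiv.Perm (Fin m) => σ ∈ HStar m hm) =
      {1, s, t, s * t} := by
    ext σ
    simp [mem_HStar_iff, ← hs, ← ht]
  unfold signedSum
  have : ∀ (inst : DecidablePred fun σ : Equiv.Perm (Fin m) => σ ∈ HStar m hm),
      ∑ σ ∈ @Finset.filter _ (fun σ : Equiv.Perm (Fin m) => σ ∈ HStar m hm) inst Finset.univ,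
        ((Equiv.Perm.sign σ : ℤ) : ℝ) * f (fun i => w (σ i)) =
      ∑ σ ∈ ({1, s, t, s * t} : Finset (Equiv.Perm (Fin m))),
        ((Equiv.Perm.sign σ : ℤ) : ℝ) * f (fun i => w (σ i)) := fun inst => by
    rw [← hfil]
    congr!
  rw [this, Finset.sum_insert (by simp [n1, n2, n3]), Finset.sum_insert (by simp [n4, n5]),
    Finset.sum_insert (by simpa using n6), Finset.sum_singleton]
  simp [hsgs, hsgt]
  ring

theorem signedSum_four {d : ℕ} (h : 4 ≤ 4) (f : (Fin 4 → Vec d) → ℝ) (w : Fin 4 → Vec d) :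
    signedSum (HStar 4 h) f w = f ![w 0, w 1, w 2, w 3] - f ![w 3, w 1, w 2, w 0] -
      f ![w 0, w 2, w 1, w 3] + f ![w 3, w 2, w 1, w 0] := by
  rw [signedSum_HStar]
  refine congrArg₂ (· + ·) (congrArg₂ (· - ·) (congrArg₂ (· - ·) (congrArg f ?_) (congrArg f ?_))
    (congrArg f ?_)) (congrArg f ?_) <;> (funext i; fin_cases i <;> rfl)

theorem signedSum_five {d : ℕ} (h : 4 ≤ 5) (f : (Fin 5 → Vec d) → ℝ) (w : Fin 5 → Vec d) :
    signedSum (HStar 5 h) f w = f ![w 0, w 1, w 2, w 3, w 4] - f ![w 3, w 1, w 2, w 0, w 4] -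
      f ![w 0, w 2, w 1, w 3, w 4] + f ![w 3, w 2, w 1, w 0, w 4] := by
  rw [signedSum_HStar]
  refine congrArg₂ (· + ·) (congrArg₂ (· - ·) (congrArg₂ (· - ·) (congrArg f ?_) (congrArg f ?_))
    (congrArg f ?_)) (congrArg f ?_) <;> (funext i; fin_cases i <;> rfl)

theorem signedSum_six {d : ℕ} (h : 4 ≤ 6) (f : (Fin 6 → Vec d) → ℝ) (w : Fin 6 → Vec d) :
    signedSum (HStar 6 h) f w =
      f ![w 0, w 1, w 2, w 3, w 4, w 5] - f ![w 3, w 1, w 2, w 0, w 4, w 5] -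
      f ![w 0, w 2, w 1, w 3, w 4, w 5] + f ![w 3, w 2, w 1, w 0, w 4, w 5] := by
  rw [signedSum_HStar]
  refine congrArg₂ (· + ·) (congrArg₂ (· - ·) (congrArg₂ (· - ·) (congrArg f ?_) (congrArg f ?_))
    (congrArg f ?_)) (congrArg f ?_) <;> (funext i; fin_cases i <;> rfl)

theorem signedSum_HStar_of_subsingleton {d m : ℕ} (hm : 4 ≤ m) [Subsingleton (Vec d)]
    (f : (Fin m → Vec d) → ℝ) (w : Fin m → Vec d) : signedSum (HStar m hm) f w = 0 := by
  have h : f = fun _ => f w := funext fun w' => by rw [Subsingleton.elim w' w]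
  rw [signedSum_HStar, h]
  ring

end SignedSum

/-! ### Projections and the Cramér–Wold device -/

section Projection

variable {d₁ d₂ : ℕ}

/-- The pair of projections of a point to the directions `p.1` and `p.2`. -/
noncomputable def projPair (p z : Vec d₁ × Vec d₂) : ℝ × ℝ := (inner ℝ p.1 z.1, inner ℝ p.2 z.2)

theorem measurable_projPair (p : Vec d₁ × Vec d₂) : Measurable (projPair p) := by
  unfold projPair; fun_prop

theorem map_projPair_ac {P : Measure (Vec d₁ × Vec d₂)} (hP : P ≪ volume) {p : Vec d₁ × Vec d₂}
    (h1 : p.1 ≠ 0) (h2 : p.2 ≠ 0) : P.map (projPair p) ≪ volume := by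
  let L : (Vec d₁ × Vec d₂) →ₗ[ℝ] ℝ × ℝ :=
    ((innerSL ℝ p.1).toLinearMap).prodMap ((innerSL ℝ p.2).toLinearMap)
  have hL : (L : Vec d₁ × Vec d₂ → ℝ × ℝ) = projPair p := by
    ext z <;> simp [L, projPair]
  have hsurj : Function.Surjective L := by
    rintro ⟨a, b⟩
    have e : ∀ {d : ℕ} {x : Vec d} (_ : x ≠ 0) (c : ℝ), inner ℝ x ((c / ‖x‖ ^ 2) • x) = c := by
      intro d x hx c
      rw [inner_smul_right, real_inner_self_eq_norm_sq]
      have := norm_ne_zero_iff.2 hx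
      field_simp
    refine ⟨((a / ‖p.1‖ ^ 2) • p.1, (b / ‖p.2‖ ^ 2) • p.2), ?_⟩
    rw [hL, projPair, e h1, e h2]
  -- A surjective linear map sends Lebesgue measure to a multiple of Lebesgue measure. The multiple
  -- may be infinite, which does not affect null sets.
  obtain ⟨c, -, hc⟩ := L.exists_map_addHaar_eq_smul_addHaar
    ((volume : Measure (Vec d₁)).prod (volume : Measure (Vec d₂)))
    ((volume : Measure ℝ).prod (volume : Measure ℝ)) hsurj
  rw [hL] at hc
  have h3 : P.map (projPair p) ≪ (volume : Measure (Vec d₁ × Vec d₂)).map (projPair p) :=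
    hP.map (measurable_projPair p)
  rw [Measure.volume_eq_prod, hc] at h3
  exact h3.trans (Measure.smul_absolutelyContinuous)

/-- The Cramér-Wold device for independence: two random vectors are independent if almost all pairs
of their projections are. -/
theorem indepFun_of_ae_map_projPair {P : Measure (Vec d₁ × Vec d₂)} [IsProbabilityMeasure P]
    (h : ∀ᵐ p ∂((stdGaussian (Vec d₁)).prod (stdGaussian (Vec d₂))),
      P.map (projPair p) = (P.map (projPair p)).fst.prod (P.map (projPair p)).snd) :
    IndepFun (Prod.fst : Vec d₁ × Vec d₂ → Vec d₁) Prod.snd P := by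
  rw [indepFun_iff_charFun_prod (by fun_prop) (by fun_prop)]
  set F : Vec d₁ × Vec d₂ → ℂ := fun p =>
    charFun (P.map fun ω : Vec d₁ × Vec d₂ => WithLp.toLp 2 (ω.1, ω.2)) (WithLp.toLp 2 p) with hF
  set G : Vec d₁ × Vec d₂ → ℂ := fun p =>
    charFun (P.map Prod.fst) p.1 * charFun (P.map Prod.snd) p.2 with hG
  have := Measure.isProbabilityMeasure_map (μ := P)
    (f := fun ω : Vec d₁ × Vec d₂ => WithLp.toLp 2 (ω.1, ω.2)) (by fun_prop)
  have := Measure.isProbabilityMeasure_map (μ := P) (f := Prod.fst) (by fun_prop)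
  have := Measure.isProbabilityMeasure_map (μ := P) (f := Prod.snd) (by fun_prop)
  have hFc : Continuous F :=
    (continuous_charFun (μ := P.map fun ω : Vec d₁ × Vec d₂ => WithLp.toLp 2 (ω.1, ω.2))).comp
      (by fun_prop)
  have hGc : Continuous G :=
    ((continuous_charFun (μ := P.map Prod.fst)).comp continuous_fst).mul
      ((continuous_charFun (μ := P.map Prod.snd)).comp continuous_snd)
  have hFG : F = G := by
    -- Characteristic functions are continuous and the Gaussian law of the directions charges every
    -- nonempty open set, so almost all pairs of directions suffice.
    rw [← Continuous.ae_eq_iff_eq ((stdGaussian (Vec d₁)).prod (stdGaussian (Vec d₂))) hFc hGc]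
    filter_upwards [h] with p hp
    set Q := P.map (projPair p) with hQ
    have hQp : IsProbabilityMeasure Q :=
      Measure.isProbabilityMeasure_map (measurable_projPair p).aemeasurable
    let e : ℝ → ℂ := fun x => Complex.exp (x * Complex.I)
    have he : Continuous e := by fun_prop
    -- The joint characteristic function at the pair of directions is that of the projected law `Q`
    -- at `(1, 1)`; it factors because `Q` is a product.
    have e1 : F p = ∫ q, e q.1 * e q.2 ∂Q := by
      simp only [hF]
      rw [hQ, charFun_apply, integral_map (by fun_prop) (by fun_prop),
        integral_map (measurable_projPair p).aemeasurable (by fun_prop)]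
      refine integral_congr_ae (ae_of_all _ fun z => ?_)
      simp only [e, projPair, ← Complex.exp_add, ← add_mul, ← Complex.ofReal_add,
        WithLp.prod_inner_apply]
      rw [real_inner_comm p.1, real_inner_comm p.2]
    have e2 : charFun (P.map Prod.fst) p.1 = ∫ x, e x ∂Q.fst := by
      rw [hQ, charFun_apply, Measure.fst, integral_map (by fun_prop) (by fun_prop),
        integral_map (by fun_prop) (by fun_prop),
        integral_map (measurable_projPair p).aemeasurable (by fun_prop)]
      refine integral_congr_ae (ae_of_all _ fun z => ?_)
      simp only [e, projPair]
      rw [real_inner_comm p.1]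
    have e3 : charFun (P.map Prod.snd) p.2 = ∫ x, e x ∂Q.snd := by
      rw [hQ, charFun_apply, Measure.snd, integral_map (by fun_prop) (by fun_prop),
        integral_map (by fun_prop) (by fun_prop),
        integral_map (measurable_projPair p).aemeasurable (by fun_prop)]
      refine integral_congr_ae (ae_of_all _ fun z => ?_)
      simp only [e, projPair]
      rw [real_inner_comm p.2]
    rw [e1, hG]
    simp only
    rw [e2, e3, ← integral_prod_mul, ← hp]
  intro t
  exact congrFun hFG t.ofLp

end Projection

/-! ### Consistency of mixtures -/

section Representation

variable {d₁ d₂ m : ℕ} {P : Measure (Vec d₁ × Vec d₂)} [IsProbabilityMeasure P]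

/-- A generalized symmetric covariance whose signed sums are mixtures is consistent at `P` if the
mixed statistics have nonnegative expectations whose vanishing forces independence. -/
theorem GSC.consistent_of_mixture (κ : GSC d₁ d₂ m) {Ω₁ Ω₂ : Type*} [MeasurableSpace Ω₁]
    [MeasurableSpace Ω₂] {ν₁ : Measure Ω₁} {ν₂ : Measure Ω₂} [SFinite ν₁] [SFinite ν₂]
    {s₁ : Ω₁ → (Fin m → Vec d₁) → ℝ} {s₂ : Ω₂ → (Fin m → Vec d₂) → ℝ}
    (h₁ : ∀ᵐ z ∂(Measure.pi fun _ : Fin m => P),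
      signedSum κ.H κ.f₁ (fun i => (z i).1) = ∫ ω, s₁ ω (fun i => (z i).1) ∂ν₁)
    (h₂ : ∀ᵐ z ∂(Measure.pi fun _ : Fin m => P),
      signedSum κ.H κ.f₂ (fun i => (z i).2) = ∫ ω, s₂ ω (fun i => (z i).2) ∂ν₂)
    (hi : Integrable (fun q : (Fin m → Vec d₁ × Vec d₂) × (Ω₁ × Ω₂) =>
      s₁ q.2.1 (fun i => (q.1 i).1) * s₂ q.2.2 (fun i => (q.1 i).2))
      ((Measure.pi fun _ : Fin m => P).prod (ν₁.prod ν₂)))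
    (hpos : ∀ᵐ ω ∂(ν₁.prod ν₂), 0 ≤ ∫ z, s₁ ω.1 (fun i => (z i).1) * s₂ ω.2 (fun i => (z i).2)
      ∂(Measure.pi fun _ : Fin m => P))
    (hzero : (∀ᵐ ω ∂(ν₁.prod ν₂), ∫ z, s₁ ω.1 (fun i => (z i).1) * s₂ ω.2 (fun i => (z i).2)
      ∂(Measure.pi fun _ : Fin m => P) = 0) →
      IndepFun (Prod.fst : Vec d₁ × Vec d₂ → Vec d₁) Prod.snd P) :
    Integrable κ.depKernel (Measure.pi fun _ : Fin m => P) ∧ 0 ≤ κ.value P ∧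
      (κ.value P = 0 → IndepFun (Prod.fst : Vec d₁ × Vec d₂ → Vec d₁) Prod.snd P) := by
  -- The mixing parameters of the two signed sums are taken independent, so the product of the
  -- averages is an average over the product measure. Fubini then moves the expectation inside.
  have hker : (fun z => ∫ ω, s₁ ω.1 (fun i => (z i).1) * s₂ ω.2 (fun i => (z i).2)
      ∂(ν₁.prod ν₂)) =ᵐ[Measure.pi fun _ : Fin m => P] κ.depKernel := by
    filter_upwards [h₁, h₂] with z hz1 hz2
    rw [GSC.depKernel, hz1, hz2]
    exact integral_prod_mul (fun ω => s₁ ω fun i => (z i).1) fun ω => s₂ ω fun i => (z i).2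
  have hval : κ.value P = ∫ ω, ∫ z, s₁ ω.1 (fun i => (z i).1) * s₂ ω.2 (fun i => (z i).2)
      ∂(Measure.pi fun _ : Fin m => P) ∂(ν₁.prod ν₂) := by
    rw [GSC.value, ← integral_congr_ae hker]
    exact integral_integral_swap hi
  refine ⟨hi.integral_prod_left.congr hker, ?_, fun h0 => hzero ?_⟩
  · rw [hval]
    exact integral_nonneg_of_ae hpos
  · rw [hval, integral_eq_zero_iff_of_nonneg_ae hpos hi.integral_prod_right] at h0
    exact h0

theorem integral_pi_projPair (p : Vec d₁ × Vec d₂) {f : (Fin m → ℝ × ℝ) → ℝ}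
    (hf : Measurable f) :
    ∫ z, f (fun i => projPair p (z i)) ∂(Measure.pi fun _ : Fin m => P) =
      ∫ w, f w ∂(Measure.pi fun _ : Fin m => P.map (projPair p)) := by
  have mp := measurePreserving_pi_map P (τ := Fin m) (measurable_projPair p)
  rw [← mp.map_eq, integral_map mp.measurable.aemeasurable hf.aestronglyMeasurable]

theorem ae_map_projPair_ac {P : Measure (Vec d₁ × Vec d₂)} (hd₁ : d₁ ≠ 0) (hd₂ : d₂ ≠ 0) (hP : P ≪ volume) :
    ∀ᵐ p ∂((stdGaussian (Vec d₁)).prod (stdGaussian (Vec d₂))),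
      P.map (projPair p) ≪ volume := by
  filter_upwards [Measure.quasiMeasurePreserving_fst.ae (ae_ne_zero_stdGaussian hd₁),
    Measure.quasiMeasurePreserving_snd.ae (ae_ne_zero_stdGaussian hd₂)] with p h1 h2
  exact map_projPair_ac hP h1 h2

/-- A generalized symmetric covariance obtained by averaging a bivariate one over all projections
is consistent if the bivariate one is. -/
theorem GSC.consistent_of_projection (κ : GSC d₁ d₂ m) (hd₁ : d₁ ≠ 0) (hd₂ : d₂ ≠ 0)
    (hP : P ≪ volume) {t₁ t₂ : (Fin m → ℝ) → ℝ} (m₁ : Measurable t₁) (m₂ : Measurable t₂)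
    {C : ℝ} (b₁ : ∀ u, |t₁ u| ≤ C) (b₂ : ∀ u, |t₂ u| ≤ C)
    (h₁ : ∀ᵐ z ∂(Measure.pi fun _ : Fin m => P), signedSum κ.H κ.f₁ (fun i => (z i).1) =
      ∫ θ, t₁ (fun i => inner ℝ θ (z i).1) ∂(stdGaussian (Vec d₁)))
    (h₂ : ∀ᵐ z ∂(Measure.pi fun _ : Fin m => P), signedSum κ.H κ.f₂ (fun i => (z i).2) =
      ∫ θ, t₂ (fun i => inner ℝ θ (z i).2) ∂(stdGaussian (Vec d₂)))
    (hpos : ∀ (Q : Measure (ℝ × ℝ)) [IsProbabilityMeasure Q], Q ≪ volume →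
      0 ≤ ∫ w, t₁ (fun i => (w i).1) * t₂ (fun i => (w i).2) ∂(Measure.pi fun _ : Fin m => Q))
    (hzero : ∀ (Q : Measure (ℝ × ℝ)) [IsProbabilityMeasure Q], Q ≪ volume →
      ∫ w, t₁ (fun i => (w i).1) * t₂ (fun i => (w i).2) ∂(Measure.pi fun _ : Fin m => Q) = 0 →
      Q = Q.fst.prod Q.snd) :
    Integrable κ.depKernel (Measure.pi fun _ : Fin m => P) ∧ 0 ≤ κ.value P ∧
      (κ.value P = 0 → IndepFun (Prod.fst : Vec d₁ × Vec d₂ → Vec d₁) Prod.snd P) := by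
  have hint : ∀ p : Vec d₁ × Vec d₂,
      ∫ z, t₁ (fun i => inner ℝ p.1 (z i).1) * t₂ (fun i => inner ℝ p.2 (z i).2)
        ∂(Measure.pi fun _ : Fin m => P) =
      ∫ w, t₁ (fun i => (w i).1) * t₂ (fun i => (w i).2)
        ∂(Measure.pi fun _ : Fin m => P.map (projPair p)) := fun p =>
    integral_pi_projPair p (f := fun w => t₁ (fun i => (w i).1) * t₂ (fun i => (w i).2))
      (by fun_prop)
  have hprob : ∀ p, IsProbabilityMeasure (P.map (projPair p)) := fun p =>
    Measure.isProbabilityMeasure_map (measurable_projPair p).aemeasurable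
  refine κ.consistent_of_mixture (ν₁ := stdGaussian (Vec d₁)) (ν₂ := stdGaussian (Vec d₂))
    (s₁ := fun θ x => t₁ fun i => inner ℝ θ (x i)) (s₂ := fun θ x => t₂ fun i => inner ℝ θ (x i))
    h₁ h₂ ?_ ?_ ?_
  · exact integrable_of_abs_le (by fun_prop) fun q => abs_mul_le_of_le (b₁ _) (b₂ _)
  · filter_upwards [ae_map_projPair_ac hd₁ hd₂ hP] with p hp
    rw [hint]
    exact hpos _ hp
  · intro h
    apply indepFun_of_ae_map_projPair
    filter_upwards [h, ae_map_projPair_ac hd₁ hd₂ hP] with p h1 h2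
    rw [hint] at h1
    exact hzero _ h2 h1

theorem indepFun_of_subsingleton (h : Subsingleton (Vec d₁) ∨ Subsingleton (Vec d₂)) :
    IndepFun (Prod.fst : Vec d₁ × Vec d₂ → Vec d₁) Prod.snd P := by
  rcases h with h | h
  · have : (Prod.fst : Vec d₁ × Vec d₂ → Vec d₁) = fun _ => 0 := by
      ext1 z; exact Subsingleton.elim _ _
    rw [this]
    exact indepFun_const_left 0 _
  · have : (Prod.snd : Vec d₁ × Vec d₂ → Vec d₂) = fun _ => 0 := by
      ext1 z; exact Subsingleton.elim _ _
    rw [this]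
    exact indepFun_const_right _ 0

/-- In dimension zero, the dependence kernels vanish. -/
theorem GSC.consistent_of_subsingleton (κ : GSC d₁ d₂ m) (hm : 4 ≤ m) (hκ : κ.H = HStar m hm)
    (h : Subsingleton (Vec d₁) ∨ Subsingleton (Vec d₂)) :
    Integrable κ.depKernel (Measure.pi fun _ : Fin m => P) ∧ 0 ≤ κ.value P ∧
      (κ.value P = 0 → IndepFun (Prod.fst : Vec d₁ × Vec d₂ → Vec d₁) Prod.snd P) := by
  have h0 : κ.depKernel = fun _ => 0 := by
    ext z
    rw [GSC.depKernel, hκ]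
    rcases h with h | h
    · rw [signedSum_HStar_of_subsingleton hm κ.f₁, zero_mul]
    · rw [signedSum_HStar_of_subsingleton hm κ.f₂, mul_zero]
  refine ⟨?_, ?_, fun _ => indepFun_of_subsingleton h⟩
  · rw [h0]; exact integrable_const 0
  · rw [GSC.value, h0, integral_zero]

/-- Only in positive dimension is a Gaussian direction almost surely nonzero and are sample points
almost surely distinct, so dimension zero is split off. -/
theorem GSC.dConsistent_of_pos (κ : GSC d₁ d₂ m) (hm : 4 ≤ m) (hκ : κ.H = HStar m hm)
    (h : d₁ ≠ 0 → d₂ ≠ 0 → κ.DConsistent κ.acFamily) : κ.DConsistent κ.acFamily := by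
  have hs : ∀ d, d = 0 → Subsingleton (Vec d) := fun d hd => by subst hd; infer_instance
  by_cases h1 : d₁ = 0
  · intro P hP
    have := hP.1
    exact κ.consistent_of_subsingleton hm hκ (Or.inl (hs _ h1))
  · by_cases h2 : d₂ = 0
    · intro P hP
      have := hP.1
      exact κ.consistent_of_subsingleton hm hκ (Or.inr (hs _ h2))
    · exact h h1 h2

theorem ae_pi_fst_injective (hd₁ : d₁ ≠ 0) (hP : P ≪ volume) :
    ∀ᵐ z ∂(Measure.pi fun _ : Fin m => P), Function.Injective fun i => (z i).1 := by
  have : Nonempty (Fin d₁) := ⟨⟨0, Nat.pos_of_ne_zero hd₁⟩⟩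
  refine ae_pi_injective P measurable_fst fun b => hP ?_
  have h : {x : Vec d₁ × Vec d₂ | x.1 = b} = {b} ×ˢ Set.univ := by ext p; simp
  rw [h, Measure.volume_eq_prod, Measure.prod_prod, measure_singleton, zero_mul]

theorem ae_pi_snd_injective (hd₂ : d₂ ≠ 0) (hP : P ≪ volume) :
    ∀ᵐ z ∂(Measure.pi fun _ : Fin m => P), Function.Injective fun i => (z i).2 := by
  have : Nonempty (Fin d₂) := ⟨⟨0, Nat.pos_of_ne_zero hd₂⟩⟩
  refine ae_pi_injective P measurable_snd fun b => hP ?_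
  have h : {x : Vec d₁ × Vec d₂ | x.2 = b} = Set.univ ×ˢ {b} := by ext p; simp
  rw [h, Measure.volume_eq_prod, Measure.prod_prod, measure_singleton, mul_zero]

end Representation

/-! ### Case (b): orthants -/

section Ordering

/-- The signed sum of the marginal-ordering kernel. -/
noncomputable def orderingStat {d : ℕ} (w : Fin 5 → Vec d) : ℝ :=
  1 / 2 * alt fun i => relInd CompLE (w 4) (w i.castSucc)

/-- The kernel is half a product of two indicators with common corner `w 4`, and the four signed
terms are the expansion of `(h₀ - h₃)(h₁ - h₂)`. -/
theorem signedSum_kerM {d : ℕ} (h : 4 ≤ 5) (w : Fin 5 → Vec d) :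
    signedSum (HStar 5 h) kerM w = orderingStat w := by
  have e : ∀ a b c d₀ e₀ : Vec d, kerM ![a, b, c, d₀, e₀] =
      1 / 2 * (relInd CompLE e₀ a * relInd CompLE e₀ b) := by
    intro a b c d₀ e₀
    by_cases h1 : CompLE a e₀ <;> by_cases h2 : CompLE b e₀ <;> simp [kerM, relInd, h1, h2]
  rw [signedSum_five]
  simp only [e]
  change _ = 1 / 2 * ((relInd CompLE (w 4) (w 0) - relInd CompLE (w 4) (w 3)) *
    (relInd CompLE (w 4) (w 1) - relInd CompLE (w 4) (w 2)))
  ring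

@[fun_prop]
theorem measurable_orderingStat {d : ℕ} : Measurable (orderingStat : (Fin 5 → Vec d) → ℝ) :=
  (measurable_alt.comp (measurable_pi_lambda _ fun i =>
    (measurable_relInd (hasZeroSetProperty_vec d).1).comp
      (by fun_prop : Measurable fun x : Fin 5 → Vec d => (x 4, x i.castSucc)))).const_mul _

theorem abs_orderingStat_le {d : ℕ} (w : Fin 5 → Vec d) : |orderingStat w| ≤ 1 / 2 * 4 :=
  abs_mul_le_of_le (by norm_num [abs_of_pos]) (abs_alt_le fun _ => abs_relInd_le _ _ _)

theorem gscM_dConsistent (d₁ d₂ : ℕ) : (gscM d₁ d₂).DConsistent (gscM d₁ d₂).acFamily := by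
  rintro P ⟨hP, hac, -, -⟩
  have mc₁ : Measurable (Function.uncurry fun (w : Fin 1 → Vec d₁ × Vec d₂)
      (q : Vec d₁ × Vec d₂) => relInd CompLE (w 0).1 q.1) :=
    (measurable_relInd (hasZeroSetProperty_vec d₁).1).comp (by fun_prop : Measurable
      fun p : (Fin 1 → Vec d₁ × Vec d₂) × (Vec d₁ × Vec d₂) => ((p.1 0).1, p.2.1))
  have mc₂ : Measurable (Function.uncurry fun (w : Fin 1 → Vec d₁ × Vec d₂)
      (q : Vec d₁ × Vec d₂) => relInd CompLE (w 0).2 q.2) :=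
    (measurable_relInd (hasZeroSetProperty_vec d₂).1).comp (by fun_prop : Measurable
      fun p : (Fin 1 → Vec d₁ × Vec d₂) × (Vec d₁ × Vec d₂) => ((p.1 0).2, p.2.2))
  have hI : ∫ z : Fin 5 → Vec d₁ × Vec d₂,
      orderingStat (fun i => (z i).1) * orderingStat (fun i => (z i).2)
        ∂(Measure.pi fun _ => P) =
      1 / 4 * ∫ w : Fin 1 → Vec d₁ × Vec d₂, 4 * covar P (fun q => relInd CompLE (w 0).1 q.1)
        (fun q => relInd CompLE (w 0).2 q.2) ^ 2 ∂(Measure.pi fun _ => P) := by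
    have h5 := integral_alt_mul_alt_param P (κ := Fin 1) (m := 5)
      (e := Sum.elim (fun i : Fin 4 => i.castSucc) fun _ => 4) (by decide)
      (h := fun w p => relInd CompLE (w 0).1 p.1) (g := fun w p => relInd CompLE (w 0).2 p.2)
      mc₁ mc₂ (fun _ _ => abs_relInd_le _ _ _) (fun _ _ => abs_relInd_le _ _ _)
    rw [← h5, ← integral_const_mul]
    refine integral_congr_ae (ae_of_all _ fun z => ?_)
    simp only [Sum.elim_inl, Sum.elim_inr, orderingStat]
    ring
  -- No averaging is needed here: the mixing measures are point masses on a one-point space.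
  refine (gscM d₁ d₂).consistent_of_mixture (ν₁ := Measure.dirac ()) (ν₂ := Measure.dirac ())
    (s₁ := fun _ x => orderingStat x) (s₂ := fun _ x => orderingStat x)
    (ae_of_all _ fun z => ?_) (ae_of_all _ fun z => ?_) ?_ (ae_of_all _ fun _ => ?_) fun h0 => ?_
  · rw [integral_dirac]; exact signedSum_kerM (by norm_num) _
  · rw [integral_dirac]; exact signedSum_kerM (by norm_num) _
  · exact integrable_of_abs_le (by fun_prop) fun q =>
      abs_mul_le_of_le (abs_orderingStat_le _) (abs_orderingStat_le _)
  · rw [hI]; positivity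
  · have h1 : ∀ᵐ ω : Unit × Unit ∂(Measure.dirac ()).prod (Measure.dirac ()),
        ∫ w : Fin 1 → Vec d₁ × Vec d₂, 4 * covar P (fun q => relInd CompLE (w 0).1 q.1)
          (fun q => relInd CompLE (w 0).2 q.2) ^ 2 ∂(Measure.pi fun _ => P) = 0 := by
      filter_upwards [h0] with ω hω
      rw [hI] at hω
      linarith
    obtain ⟨-, h2⟩ := h1.exists
    have h3 := covar_eq_zero_of_integral_eq_zero P mc₁ mc₂ (fun _ _ => abs_relInd_le _ _ _)
      (fun _ _ => abs_relInd_le _ _ _) h2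
    have h4 : P = P.fst.prod P.snd :=
      eq_prod_of_ae_covar_eq_zero (hasZeroSetProperty_vec d₁) (hasZeroSetProperty_vec d₂) hac
        (Or.inl (((measurePreserving_funUnique P (Fin 1)).symm _).quasiMeasurePreserving.ae h3))
    rw [indepFun_iff_map_prod_eq_prod_map_map (by fun_prop) (by fun_prop)]
    simpa [Measure.fst, Measure.snd] using h4

end Ordering

/-! ### Cases (c), (d), (e): angles -/

section Angle

theorem integral_signed_four {α : Type*} [MeasurableSpace α] {μ : Measure α}
    {f₁ f₂ f₃ f₄ : α → ℝ} (h₁ : Integrable f₁ μ) (h₂ : Integrable f₂ μ) (h₃ : Integrable f₃ μ)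
    (h₄ : Integrable f₄ μ) :
    ∫ x, f₁ x ∂μ - ∫ x, f₂ x ∂μ - ∫ x, f₃ x ∂μ + ∫ x, f₄ x ∂μ =
      ∫ x, (f₁ x - f₂ x - f₃ x + f₄ x) ∂μ := by
  have e := integral_add ((h₁.sub h₂).sub h₃) h₄
  have e' := integral_sub (h₁.sub h₂) h₃
  have e'' := integral_sub h₁ h₂
  simp only [Pi.sub_apply] at e e' e''
  rw [e, e', e'']

/-- The indicator of `b < a` and `c ≤ d`. -/
noncomputable def sep (a b c d : ℝ) : ℝ := (1 - thr b a) * thr d c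

@[fun_prop]
theorem Measurable.sep {α : Type*} [MeasurableSpace α] {a b c d : α → ℝ} (ha : Measurable a)
    (hb : Measurable b) (hc : Measurable c) (hd : Measurable d) :
    Measurable fun x => sep (a x) (b x) (c x) (d x) := by
  unfold _root_.sep; fun_prop

theorem abs_sep_le (a b c d : ℝ) : |sep a b c d| ≤ 1 := by
  unfold sep thr; split_ifs <;> norm_num

/-- The normalized angle as an average over random half-spaces. -/
theorem Arc_eq_integral_sep {k : ℕ} {a b c d : Vec k} (hab : a ≠ b) (hcd : c ≠ d) :
    Arc (a - b) (c - d) = ∫ θ, sep (inner ℝ θ a) (inner ℝ θ b) (inner ℝ θ c) (inner ℝ θ d)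
      ∂(stdGaussian (Vec k)) := by
  rw [← stdGaussian_wedge_eq_Arc (sub_ne_zero.2 hab) (sub_ne_zero.2 hcd)]
  have hm : MeasurableSet
      {θ : Vec k | 0 < (inner ℝ θ (a - b) : ℝ) ∧ (inner ℝ θ (c - d) : ℝ) ≤ 0} :=
    (measurableSet_lt (g := fun θ : Vec k => (inner ℝ θ (a - b) : ℝ)) measurable_const
      (by fun_prop)).inter
      (measurableSet_le (f := fun θ : Vec k => (inner ℝ θ (c - d) : ℝ)) (by fun_prop)
        measurable_const)
  rw [← integral_indicator_one hm]
  congr 1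
  ext θ
  have h1 : 0 < (inner ℝ θ (a - b) : ℝ) ↔ ¬ (inner ℝ θ a : ℝ) ≤ inner ℝ θ b := by
    rw [inner_sub_right, sub_pos, not_le]
  have h2 : (inner ℝ θ (c - d) : ℝ) ≤ 0 ↔ (inner ℝ θ c : ℝ) ≤ inner ℝ θ d := by
    rw [inner_sub_right, sub_nonpos]
  simp only [Set.indicator_apply, Set.mem_ofPred_eq, h1, h2, sep, thr]
  by_cases h3 : (inner ℝ θ a : ℝ) ≤ inner ℝ θ b <;>
    by_cases h4 : (inner ℝ θ c : ℝ) ≤ inner ℝ θ d <;> simp [h3, h4]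

theorem integrable_sep_inner {k : ℕ} (a b c d : Vec k) :
    Integrable (fun θ => sep (inner ℝ θ a) (inner ℝ θ b) (inner ℝ θ c) (inner ℝ θ d))
      (stdGaussian (Vec k)) :=
  integrable_of_abs_le (by fun_prop) fun _ => abs_sep_le _ _ _ _

/-- The signed sum of the angle at a fixed vertex, as an average of alternating products. -/
theorem signedSum_Arc {k : ℕ} {w : Fin 4 → Vec k} {c : Vec k} (hw : ∀ i, w i ≠ c) :
    1 / 2 * Arc (w 0 - c) (w 1 - c) - 1 / 2 * Arc (w 3 - c) (w 1 - c) -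
      1 / 2 * Arc (w 0 - c) (w 2 - c) + 1 / 2 * Arc (w 3 - c) (w 2 - c) =
    ∫ θ, -(1 / 2) * alt (fun i => thr (inner ℝ θ c) (inner ℝ θ (w i))) ∂(stdGaussian (Vec k)) := by
  have i := integrable_sep_inner (k := k)
  simp only [Arc_eq_integral_sep (hw _) (hw _)]
  rw [← mul_sub, ← mul_sub, ← mul_add,
    integral_signed_four (i _ _ _ _) (i _ _ _ _) (i _ _ _ _) (i _ _ _ _), ← integral_const_mul]
  -- With `h` the half-space indicator, each angle contributes `(1 - hᵢ) hⱼ`. The constants cancel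
  -- in the signed sum, and the complement in the first factor produces the minus sign.
  refine integral_congr_ae (ae_of_all _ fun θ => ?_)
  simp only [sep, alt]
  ring

theorem abs_neg_half_alt_le {x : Fin 4 → ℝ} (hx : ∀ i, |x i| ≤ 1) :
    |-(1 / 2) * alt x| ≤ 1 / 2 * 4 :=
  abs_mul_le_of_le (by norm_num [abs_of_pos]) (abs_alt_le hx)

theorem gscD_dConsistent (d₁ d₂ : ℕ) : (gscD d₁ d₂).DConsistent (gscD d₁ d₂).acFamily := by
  refine GSC.dConsistent_of_pos _ (by norm_num) rfl fun hd₁ hd₂ => ?_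
  rintro P ⟨hP, hac, -, -⟩
  have hS : ∀ {d : ℕ} (w : Fin 5 → Vec d), Function.Injective w →
      signedSum (HStar 5 (by norm_num)) kerD w = ∫ θ, -(1 / 2) *
        alt (fun i => thr (inner ℝ θ (w 4)) (inner ℝ θ (w i.castSucc))) ∂(stdGaussian (Vec d)) := by
    intro d w hw
    rw [signedSum_five]
    exact signedSum_Arc (w := fun i => w i.castSucc) fun i => hw.ne (by
      revert i; decide)
  have hI : ∀ (Q : Measure (ℝ × ℝ)) [IsProbabilityMeasure Q],
      ∫ w : Fin 5 → ℝ × ℝ, (-(1 / 2) * alt fun i => thr (w 4).1 (w i.castSucc).1) *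
        (-(1 / 2) * alt fun i => thr (w 4).2 (w i.castSucc).2) ∂(Measure.pi fun _ => Q) =
      1 / 4 * ∫ w : Fin 1 → ℝ × ℝ, 4 * cdfGap Q (w 0).1 (w 0).2 ^ 2 ∂(Measure.pi fun _ => Q) := by
    intro Q hQ
    rw [← integral_alt_thr_mul_alt_thr_five, ← integral_const_mul]
    refine integral_congr_ae (ae_of_all _ fun z => ?_)
    ring
  refine (gscD d₁ d₂).consistent_of_projection hd₁ hd₂ hac (C := 1 / 2 * 4)
    (t₁ := fun u => -(1 / 2) * alt fun i => thr (u 4) (u i.castSucc))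
    (t₂ := fun u => -(1 / 2) * alt fun i => thr (u 4) (u i.castSucc))
    (by fun_prop) (by fun_prop) (fun u => abs_neg_half_alt_le fun _ => abs_thr_le _ _)
    (fun u => abs_neg_half_alt_le fun _ => abs_thr_le _ _) ?_ ?_ ?_ ?_
  · filter_upwards [ae_pi_fst_injective hd₁ hac] with z hz using hS _ hz
  · filter_upwards [ae_pi_snd_injective hd₂ hac] with z hz using hS _ hz
  · intro Q hQ _
    rw [hI Q]; positivity
  · intro Q hQ hQac h
    rw [hI Q] at h
    exact eq_prod_of_integral_cdfGap_one hQac (by linarith)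

theorem gscR_dConsistent (d₁ d₂ : ℕ) : (gscR d₁ d₂).DConsistent (gscR d₁ d₂).acFamily := by
  refine GSC.dConsistent_of_pos _ (by norm_num) rfl fun hd₁ hd₂ => ?_
  rintro P ⟨hP, hac, -, -⟩
  have hS₁ : ∀ {d : ℕ} (w : Fin 6 → Vec d), Function.Injective w →
      signedSum (HStar 6 (by norm_num)) kerR₁ w = ∫ θ, -(1 / 2) *
        alt (fun i => thr (inner ℝ θ (w 4)) (inner ℝ θ (w (i.castAdd 2))))
          ∂(stdGaussian (Vec d)) := by
    intro d w hw
    rw [signedSum_six]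
    exact signedSum_Arc (w := fun i => w (i.castAdd 2)) fun i => hw.ne (by
      revert i; decide)
  have hS₂ : ∀ {d : ℕ} (w : Fin 6 → Vec d), Function.Injective w →
      signedSum (HStar 6 (by norm_num)) kerR₂ w = ∫ θ, -(1 / 2) *
        alt (fun i => thr (inner ℝ θ (w 5)) (inner ℝ θ (w (i.castAdd 2))))
          ∂(stdGaussian (Vec d)) := by
    intro d w hw
    rw [signedSum_six]
    exact signedSum_Arc (w := fun i => w (i.castAdd 2)) fun i => hw.ne (by
      revert i; decide)
  have hI : ∀ (Q : Measure (ℝ × ℝ)) [IsProbabilityMeasure Q],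
      ∫ w : Fin 6 → ℝ × ℝ, (-(1 / 2) * alt fun i => thr (w 4).1 (w (i.castAdd 2)).1) *
        (-(1 / 2) * alt fun i => thr (w 5).2 (w (i.castAdd 2)).2) ∂(Measure.pi fun _ => Q) =
      1 / 4 * ∫ w : Fin 2 → ℝ × ℝ, 4 * cdfGap Q (w 0).1 (w 1).2 ^ 2 ∂(Measure.pi fun _ => Q) := by
    intro Q hQ
    rw [← integral_alt_thr_mul_alt_thr_six, ← integral_const_mul]
    refine integral_congr_ae (ae_of_all _ fun z => ?_)
    ring
  refine (gscR d₁ d₂).consistent_of_projection hd₁ hd₂ hac (C := 1 / 2 * 4)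
    (t₁ := fun u => -(1 / 2) * alt fun i => thr (u 4) (u (i.castAdd 2)))
    (t₂ := fun u => -(1 / 2) * alt fun i => thr (u 5) (u (i.castAdd 2)))
    (by fun_prop) (by fun_prop) (fun u => abs_neg_half_alt_le fun _ => abs_thr_le _ _)
    (fun u => abs_neg_half_alt_le fun _ => abs_thr_le _ _) ?_ ?_ ?_ ?_
  · filter_upwards [ae_pi_fst_injective hd₁ hac] with z hz using hS₁ _ hz
  · filter_upwards [ae_pi_snd_injective hd₂ hac] with z hz using hS₂ _ hz
  · intro Q hQ _
    rw [hI Q]; positivity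
  · intro Q hQ hQac h
    rw [hI Q] at h
    exact eq_prod_of_integral_cdfGap_two hQac (by linarith)

/-- One-dimensional form of the kernel of the projection-averaging `τ*`. -/
noncomputable def sepKer (a b c d : ℝ) : ℝ := sep a b b c + sep b a a d

/-- The signed sum of `sepKer`. -/
noncomputable def sepSum (u : Fin 4 → ℝ) : ℝ :=
  sepKer (u 0) (u 1) (u 2) (u 3) - sepKer (u 3) (u 1) (u 2) (u 0) -
    sepKer (u 0) (u 2) (u 1) (u 3) + sepKer (u 3) (u 2) (u 1) (u 0)

@[fun_prop]
theorem measurable_sepSum : Measurable sepSum := by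
  unfold sepSum sepKer; fun_prop

theorem abs_sepSum_le (u : Fin 4 → ℝ) : |sepSum u| ≤ 8 := by
  have h : ∀ a b c d, |sepKer a b c d| ≤ 2 := fun a b c d =>
    (abs_add_le _ _).trans (by linarith [abs_sep_le a b b c, abs_sep_le b a a d])
  have h1 := abs_le.1 (h (u 0) (u 1) (u 2) (u 3))
  have h2 := abs_le.1 (h (u 3) (u 1) (u 2) (u 0))
  have h3 := abs_le.1 (h (u 0) (u 2) (u 1) (u 3))
  have h4 := abs_le.1 (h (u 3) (u 2) (u 1) (u 0))
  rw [sepSum, abs_le]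
  constructor <;> linarith

/-- Integer form of `sepKer`, for ranks. -/
def rankSepKer (a b c d : Fin 5) : ℤ :=
  (1 - rankThr b a) * rankThr c b + (1 - rankThr a b) * rankThr d a

/-- Four distinct ranks are taken in `Fin 5`, so that the identity is stated with the same `rankTau`
as the five-point ones. -/
theorem rankSepKer_signed_sum : ∀ a b c d : Fin 5, [a, b, c, d].Nodup →
    rankSepKer a b c d - rankSepKer d b c a - rankSepKer a c b d + rankSepKer d c b a =
      -rankTau a b c d := by
  decide +kernel

/-- Without ties, the signed sum of `sepKer` is the sign covariance kernel. -/
theorem sepSum_eq_neg_tauKer {u : Fin 4 → ℝ} (hu : Function.Injective u) :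
    sepSum u = -tauKer u := by
  obtain ⟨τ, hτ⟩ := exists_perm_le_iff hu
  set r : Fin 4 → Fin 5 := fun i => (τ.symm i).castSucc with hr
  have hri : Function.Injective r := (Fin.castSucc_injective 4).comp τ.symm.injective
  have hx : ∀ i j, u i ≤ u j ↔ r i ≤ r j := fun i j => by
    simpa [hr] using hτ (τ.symm i) (τ.symm j)
  have h := rankSepKer_signed_sum (r 0) (r 1) (r 2) (r 3) (by simp [hri.eq_iff])
  have h' := congrArg (Int.cast : ℤ → ℝ) h
  simp only [rankSepKer, rankTau, rankAltThr, rankAlt] at h'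
  push_cast at h'
  simp only [sepSum, sepKer, sep, tauKer, Fin.sum_univ_four, alt, thr_eq_rankThr hx]
  exact h'

theorem signedSum_kerTau {d : ℕ} (h : 4 ≤ 4) {w : Fin 4 → Vec d} (hw : Function.Injective w) :
    signedSum (HStar 4 h) kerTau w =
      ∫ θ, sepSum (fun i => inner ℝ θ (w i)) ∂(stdGaussian (Vec d)) := by
  have i := integrable_sep_inner (k := d)
  have hK : ∀ {a b c e : Vec d}, a ≠ b → b ≠ c → a ≠ e → kerTau ![a, b, c, e] =
      ∫ θ, sepKer (inner ℝ θ a) (inner ℝ θ b) (inner ℝ θ c) (inner ℝ θ e)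
        ∂(stdGaussian (Vec d)) := by
    intro a b c e hab hbc hae
    have h1 : kerTau ![a, b, c, e] = Arc (a - b) (b - c) + Arc (b - a) (a - e) := rfl
    rw [h1, Arc_eq_integral_sep hab hbc, Arc_eq_integral_sep hab.symm hae,
      ← integral_add (i _ _ _ _) (i _ _ _ _)]
    rfl
  have iK : ∀ a b c e : Vec d, Integrable (fun θ =>
      sepKer (inner ℝ θ a) (inner ℝ θ b) (inner ℝ θ c) (inner ℝ θ e)) (stdGaussian (Vec d)) :=
    fun a b c e => (i a b b c).add (i b a a e)
  have n : ∀ i j, i ≠ j → w i ≠ w j := fun i j hij => hw.ne hij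
  rw [signedSum_four, hK (n _ _ (by decide)) (n _ _ (by decide)) (n _ _ (by decide)),
    hK (n _ _ (by decide)) (n _ _ (by decide)) (n _ _ (by decide)),
    hK (n _ _ (by decide)) (n _ _ (by decide)) (n _ _ (by decide)),
    hK (n _ _ (by decide)) (n _ _ (by decide)) (n _ _ (by decide)),
    integral_signed_four (iK _ _ _ _) (iK _ _ _ _) (iK _ _ _ _) (iK _ _ _ _)]
  rfl

theorem gscTau_dConsistent (d₁ d₂ : ℕ) :
    (gscTau d₁ d₂).DConsistent (gscTau d₁ d₂).acFamily := by
  refine GSC.dConsistent_of_pos _ (by norm_num) rfl fun hd₁ hd₂ => ?_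
  rintro P ⟨hP, hac, -, -⟩
  have hI : ∀ (Q : Measure (ℝ × ℝ)) [IsProbabilityMeasure Q], Q ≪ volume →
      ∫ w : Fin 4 → ℝ × ℝ, sepSum (fun i => (w i).1) * sepSum (fun i => (w i).2)
        ∂(Measure.pi fun _ => Q) =
      ∫ w : Fin 4 → ℝ × ℝ, tauKer (fun i => (w i).1) * tauKer (fun i => (w i).2)
        ∂(Measure.pi fun _ => Q) := by
    intro Q hQ hQac
    refine integral_congr_ae ?_
    filter_upwards [ae_pi_injective Q measurable_fst (measure_fst_eq_zero_of_ac hQac),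
      ae_pi_injective Q measurable_snd (measure_snd_eq_zero_of_ac hQac)] with z hz1 hz2
    rw [sepSum_eq_neg_tauKer hz1, sepSum_eq_neg_tauKer hz2, neg_mul_neg]
  refine (gscTau d₁ d₂).consistent_of_projection hd₁ hd₂ hac (C := 8)
    (t₁ := sepSum) (t₂ := sepSum) (by fun_prop) (by fun_prop) abs_sepSum_le abs_sepSum_le
    ?_ ?_ ?_ ?_
  · filter_upwards [ae_pi_fst_injective hd₁ hac] with z hz using signedSum_kerTau (by norm_num) hz
  · filter_upwards [ae_pi_snd_injective hd₂ hac] with z hz using signedSum_kerTau (by norm_num) hz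
  · intro Q hQ hQac
    rw [hI Q hQac]
    exact integral_tauKer_mul_tauKer_nonneg hQac
  · intro Q hQ hQac h
    rw [hI Q hQac] at h
    exact eq_prod_of_integral_tauKer_eq_zero hQac h

end Angle

/-! ### Case (a): distances -/

section DistanceCovariance

theorem sq_thr_sub_thr (a b t : ℝ) :
    (thr t a - thr t b) ^ 2 = (Set.Ico (min a b) (max a b)).indicator 1 t := by
  by_cases h1 : a ≤ t <;> by_cases h2 : b ≤ t <;> simp [thr, Set.indicator_apply, h1, h2]

theorem integrable_sq_thr_sub_thr (a b : ℝ) : Integrable fun t => (thr t a - thr t b) ^ 2 := by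
  simp_rw [sq_thr_sub_thr]
  exact (integrable_indicator_iff measurableSet_Ico).2 (integrableOn_const (by simp) (by simp))

theorem integral_sq_thr_sub_thr (a b : ℝ) : ∫ t, (thr t a - thr t b) ^ 2 = |a - b| := by
  simp_rw [sq_thr_sub_thr]
  rw [integral_indicator_one measurableSet_Ico, Real.volume_real_Ico_of_le min_le_max,
    max_sub_min_eq_abs']

/-- Directions and thresholds of half-spaces. -/
noncomputable def halfSpaceMeasure (d : ℕ) : Measure (Vec d × ℝ) :=
  (stdGaussian (Vec d)).prod volume

instance (d : ℕ) : SFinite (halfSpaceMeasure d) :=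
  inferInstanceAs (SFinite ((stdGaussian (Vec d)).prod (volume : Measure ℝ)))

/-- The indicator of a half-space. -/
noncomputable def halfSpace {d : ℕ} (ω : Vec d × ℝ) (x : Vec d) : ℝ := thr ω.2 (inner ℝ ω.1 x)

theorem abs_halfSpace_le {d : ℕ} (ω : Vec d × ℝ) (x : Vec d) : |halfSpace ω x| ≤ 1 :=
  abs_thr_le _ _

@[fun_prop]
theorem Measurable.halfSpace {α : Type*} [MeasurableSpace α] {d : ℕ} {f : α → Vec d × ℝ}
    {g : α → Vec d} (hf : Measurable f) (hg : Measurable g) :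
    Measurable fun x => halfSpace (f x) (g x) := by
  unfold _root_.halfSpace; fun_prop

theorem integrable_sq_halfSpace_sub {d : ℕ} (x y : Vec d) :
    Integrable (fun ω => (halfSpace ω x - halfSpace ω y) ^ 2) (halfSpaceMeasure d) := by
  have hm : Measurable fun ω : Vec d × ℝ => (halfSpace ω x - halfSpace ω y) ^ 2 := by fun_prop
  rw [halfSpaceMeasure, integrable_prod_iff hm.aestronglyMeasurable]
  refine ⟨ae_of_all _ fun θ => integrable_sq_thr_sub_thr (inner ℝ θ x) (inner ℝ θ y), ?_⟩
  simp only [norm_pow, Real.norm_eq_abs, sq_abs, halfSpace, integral_sq_thr_sub_thr,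
    ← inner_sub_right]
  exact integrable_abs_inner_stdGaussian _

/-- Crofton's formula: the Euclidean distance is proportional to the measure of the half-spaces that
separate two points. -/
theorem integral_sq_halfSpace_sub {d : ℕ} (x y : Vec d) :
    ∫ ω, (halfSpace ω x - halfSpace ω y) ^ 2 ∂(halfSpaceMeasure d) =
      gaussianAbsMoment * ‖x - y‖ := by
  have hi := integrable_sq_halfSpace_sub x y
  rw [halfSpaceMeasure] at hi ⊢
  rw [integral_prod _ hi]
  simp only [halfSpace, integral_sq_thr_sub_thr, ← inner_sub_right]
  exact integral_abs_inner_stdGaussian _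

/-- By Crofton's formula the kernel is a mixture of squares `(hᵢ - hⱼ)²`. The alternation cancels
the pure squares and leaves the cross terms `-2 hᵢ hⱼ`, which assemble to `-2 alt`. No exclusion of
ties is needed. -/
theorem signedSum_kerDCov {d : ℕ} (h : 4 ≤ 4) (w : Fin 4 → Vec d) :
    signedSum (HStar 4 h) kerDCov w =
      ∫ ω, -gaussianAbsMoment⁻¹ * alt (fun i => halfSpace ω (w i)) ∂(halfSpaceMeasure d) := by
  have hc := gaussianAbsMoment_pos.ne'
  have hK : ∀ a b c e : Vec d, kerDCov ![a, b, c, e] = 1 / 2 * gaussianAbsMoment⁻¹ *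
      ∫ ω, (halfSpace ω a - halfSpace ω b) ^ 2 ∂(halfSpaceMeasure d) := by
    intro a b c e
    rw [integral_sq_halfSpace_sub]
    change 1 / 2 * ‖a - b‖ = _
    field_simp
  have i := integrable_sq_halfSpace_sub (d := d)
  rw [signedSum_four, hK, hK, hK, hK, ← mul_sub, ← mul_sub, ← mul_add,
    integral_signed_four (i _ _) (i _ _) (i _ _) (i _ _), ← integral_const_mul]
  refine integral_congr_ae (ae_of_all _ fun ω => ?_)
  simp only [alt]
  ring

/-- Of the four factors of modulus at most one, only the outer one of `h` and the inner one of `g`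
are kept. They involve disjoint pairs of sample points, so the integrability of each distance
separately suffices; no moment of the product of the two distances at the same pair is required. -/
theorem abs_alt_mul_alt_le {h g : Fin 4 → ℝ} (hh : ∀ i, h i = 0 ∨ h i = 1)
    (hg : ∀ i, g i = 0 ∨ g i = 1) : |alt h * alt g| ≤ (h 0 - h 3) ^ 2 * (g 1 - g 2) ^ 2 := by
  have key : ∀ {a b : ℝ}, (a = 0 ∨ a = 1) → (b = 0 ∨ b = 1) →
      |a - b| = (a - b) ^ 2 ∧ |a - b| ≤ 1 := by
    rintro a b (rfl | rfl) (rfl | rfl) <;> norm_num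
  rw [alt, alt, abs_mul, abs_mul, abs_mul, ← (key (hh 0) (hh 3)).1, ← (key (hg 1) (hg 2)).1]
  have h1 := (key (hh 1) (hh 2)).2
  have h2 := (key (hg 0) (hg 3)).2
  calc |h 0 - h 3| * |h 1 - h 2| * (|g 0 - g 3| * |g 1 - g 2|)
      = |h 0 - h 3| * |g 1 - g 2| * (|h 1 - h 2| * |g 0 - g 3|) := by ring
    _ ≤ |h 0 - h 3| * |g 1 - g 2| * 1 :=
        mul_le_mul_of_nonneg_left (mul_le_one₀ h1 (abs_nonneg _) h2) (by positivity)
    _ = |h 0 - h 3| * |g 1 - g 2| := mul_one _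

theorem halfSpace_eq_zero_or_one {d : ℕ} (ω : Vec d × ℝ) (x : Vec d) :
    halfSpace ω x = 0 ∨ halfSpace ω x = 1 := by
  unfold halfSpace thr; split_ifs <;> simp

theorem measurePreserving_prod_prod_comm {α β γ δ : Type*} [MeasurableSpace α] [MeasurableSpace β]
    [MeasurableSpace γ] [MeasurableSpace δ] (μa : Measure α) (μb : Measure β) (μc : Measure γ)
    (μd : Measure δ) [SFinite μa] [SFinite μb] [SFinite μc] [SFinite μd] :
    MeasurePreserving (fun p : (α × β) × (γ × δ) => ((p.1.1, p.2.1), (p.1.2, p.2.2)))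
      ((μa.prod μb).prod (μc.prod μd)) ((μa.prod μc).prod (μb.prod μd)) := by
  have h1 := measurePreserving_prodAssoc μa μb (μc.prod μd)
  have h2 : MeasurePreserving (fun p : β × (γ × δ) => (p.2.1, (p.1, p.2.2)))
      (μb.prod (μc.prod μd)) (μc.prod (μb.prod μd)) := by
    have e1 := (measurePreserving_prodAssoc μb μc μd).symm _
    have e2 := (Measure.measurePreserving_swap (μ := μb) (ν := μc)).prod (MeasurePreserving.id μd)
    have e3 := measurePreserving_prodAssoc μc μb μd
    exact e3.comp (e2.comp e1)
  have h3 := (MeasurePreserving.id μa).prod h2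
  have h4 := (measurePreserving_prodAssoc μa μc (μb.prod μd)).symm _
  exact h4.comp (h3.comp h1)

theorem integrable_norm_sub_of_kerDCov {d : ℕ} {α : Type*} [MeasurableSpace α] {P : Measure α}
    [IsProbabilityMeasure P] {f : α → Vec d} (hf : Measurable f)
    (h : Integrable (fun z : Fin 4 → α => kerDCov fun i => f (z i)) (Measure.pi fun _ => P)) :
    Integrable (fun q : α × α => ‖f q.1 - f q.2‖) (P.prod P) := by
  have h1 : Integrable ((fun q : α × α => ‖f q.1 - f q.2‖) ∘ fun z : Fin 4 → α => (z 0, z 1))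
      (Measure.pi fun _ => P) := by
    refine (h.const_mul 2).congr (ae_of_all _ fun z => ?_)
    simp [kerDCov]
  exact ((measurePreserving_pi_pair P (by decide)).integrable_comp
    (by fun_prop : Measurable _).aestronglyMeasurable).1 h1

theorem gscDCov_dConsistent (d₁ d₂ : ℕ) :
    (gscDCov d₁ d₂).DConsistent (gscDCov d₁ d₂).acFamily := by
  refine GSC.dConsistent_of_pos _ (by norm_num) rfl fun hd₁ hd₂ => ?_
  rintro P ⟨hP, hac, hf₁, hf₂⟩
  have hc := gaussianAbsMoment_pos
  have hn₁ := integrable_norm_sub_of_kerDCov (P := P) measurable_fst hf₁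
  have hn₂ := integrable_norm_sub_of_kerDCov (P := P) measurable_snd hf₂
  have hI : ∀ ω : (Vec d₁ × ℝ) × (Vec d₂ × ℝ),
      ∫ z : Fin 4 → Vec d₁ × Vec d₂, (-gaussianAbsMoment⁻¹ * alt fun i => halfSpace ω.1 (z i).1) *
        (-gaussianAbsMoment⁻¹ * alt fun i => halfSpace ω.2 (z i).2) ∂(Measure.pi fun _ => P) =
      gaussianAbsMoment⁻¹ ^ 2 *
        (4 * covar P (fun q => halfSpace ω.1 q.1) (fun q => halfSpace ω.2 q.2) ^ 2) := by
    intro ω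
    rw [← integral_alt_mul_alt P (h := fun q => halfSpace ω.1 q.1)
      (g := fun q => halfSpace ω.2 q.2) (by fun_prop) (by fun_prop)
      (fun _ => abs_halfSpace_le _ _) (fun _ => abs_halfSpace_le _ _), ← integral_const_mul]
    refine integral_congr_ae (ae_of_all _ fun z => ?_)
    ring
  refine (gscDCov d₁ d₂).consistent_of_mixture (ν₁ := halfSpaceMeasure d₁)
    (ν₂ := halfSpaceMeasure d₂)
    (s₁ := fun ω x => -gaussianAbsMoment⁻¹ * alt fun i => halfSpace ω (x i))
    (s₂ := fun ω x => -gaussianAbsMoment⁻¹ * alt fun i => halfSpace ω (x i))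
    (ae_of_all _ fun z => signedSum_kerDCov (by norm_num) _)
    (ae_of_all _ fun z => signedSum_kerDCov (by norm_num) _) ?_ (ae_of_all _ fun ω => ?_)
    fun h0 => ?_
  · set g : (Fin 4 → Vec d₁ × Vec d₂) × ((Vec d₁ × ℝ) × (Vec d₂ × ℝ)) → ℝ := fun q =>
      (halfSpace q.2.1 (q.1 0).1 - halfSpace q.2.1 (q.1 3).1) ^ 2 *
        (halfSpace q.2.2 (q.1 1).2 - halfSpace q.2.2 (q.1 2).2) ^ 2 with hg
    have hgm : Measurable g := by fun_prop
    have hgi : Integrable g ((Measure.pi fun _ : Fin 4 => P).prod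
        ((halfSpaceMeasure d₁).prod (halfSpaceMeasure d₂))) := by
      rw [integrable_prod_iff hgm.aestronglyMeasurable]
      refine ⟨ae_of_all _ fun z => (integrable_sq_halfSpace_sub (z 0).1 (z 3).1).mul_prod
        (integrable_sq_halfSpace_sub (z 1).2 (z 2).2), ?_⟩
      have hz : ∀ z, ∫ ω, ‖g (z, ω)‖ ∂((halfSpaceMeasure d₁).prod (halfSpaceMeasure d₂)) =
          gaussianAbsMoment ^ 2 * (‖(z 0).1 - (z 3).1‖ * ‖(z 1).2 - (z 2).2‖) := by
        intro z
        have e : ∀ ω, ‖g (z, ω)‖ = (halfSpace ω.1 (z 0).1 - halfSpace ω.1 (z 3).1) ^ 2 *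
            (halfSpace ω.2 (z 1).2 - halfSpace ω.2 (z 2).2) ^ 2 := fun ω => by
          rw [Real.norm_eq_abs, abs_of_nonneg (by positivity)]
        simp_rw [e]
        rw [integral_prod_mul (fun ω => (halfSpace ω (z 0).1 - halfSpace ω (z 3).1) ^ 2)
          (fun ω => (halfSpace ω (z 1).2 - halfSpace ω (z 2).2) ^ 2),
          integral_sq_halfSpace_sub, integral_sq_halfSpace_sub]
        ring
      simp_rw [hz]
      refine Integrable.const_mul ?_ _
      -- The two distances depend on the independent pairs `(z 0, z 3)` and `(z 1, z 2)`, so their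
      -- product is integrable.
      exact (measurePreserving_pi_outer_inner P).integrable_comp_of_integrable (hn₁.mul_prod hn₂)
    refine (hgi.const_mul (gaussianAbsMoment⁻¹ ^ 2)).mono' (by fun_prop) (ae_of_all _ fun q => ?_)
    have h1 := abs_alt_mul_alt_le (h := fun i => halfSpace q.2.1 (q.1 i).1)
      (g := fun i => halfSpace q.2.2 (q.1 i).2) (fun _ => halfSpace_eq_zero_or_one _ _)
      (fun _ => halfSpace_eq_zero_or_one _ _)
    rw [Real.norm_eq_abs, mul_mul_mul_comm, abs_mul, neg_mul_neg, ← pow_two,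
      abs_of_nonneg (sq_nonneg gaussianAbsMoment⁻¹)]
    exact mul_le_mul_of_nonneg_left h1 (sq_nonneg _)
  · rw [hI]; positivity
  · have h1 : ∀ᵐ ω ∂((halfSpaceMeasure d₁).prod (halfSpaceMeasure d₂)),
        covar P (fun q => halfSpace ω.1 q.1) (fun q => halfSpace ω.2 q.2) = 0 := by
      filter_upwards [h0] with ω hω
      rw [hI] at hω
      simpa [hc.ne'] using hω
    -- Regrouping the parameters as directions and thresholds shows that, for almost all pairs of
    -- directions, the covariances vanish at Lebesgue-almost all pairs of thresholds.
    have h2 := Measure.ae_ae_of_ae_prod ((measurePreserving_prod_prod_comm (stdGaussian (Vec d₁))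
      (stdGaussian (Vec d₂)) (volume : Measure ℝ) (volume : Measure ℝ)).quasiMeasurePreserving.ae
        h1)
    apply indepFun_of_ae_map_projPair
    filter_upwards [h2, ae_map_projPair_ac hd₁ hd₂ hac] with p hp hQ
    have := Measure.isProbabilityMeasure_map (μ := P) (measurable_projPair p).aemeasurable
    -- Absolute continuity of the projected law turns Lebesgue-almost all thresholds into almost all
    -- thresholds for that law, as the criterion demands.
    refine eq_prod_of_ae_cdfGap_eq_zero hQ (Or.inl (hQ.ae_le ?_))
    have hp' : ∀ᵐ q : ℝ × ℝ, covar P (fun z => halfSpace (p.1, q.1) z.1)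
        (fun z => halfSpace (p.2, q.2) z.2) = 0 := hp
    filter_upwards [hp'] with q hq
    rw [← hq, cdfGap, covar, covar, integral_map (measurable_projPair p).aemeasurable (by
        exact (by fun_prop : Measurable _).aestronglyMeasurable),
      integral_map (measurable_projPair p).aemeasurable (by
        exact (by fun_prop : Measurable _).aestronglyMeasurable),
      integral_map (measurable_projPair p).aemeasurable (by
        exact (by fun_prop : Measurable _).aestronglyMeasurable)]
    rfl

end DistanceCovariance

theorem theorem2p1 (d₁ d₂ : ℕ) :
    (gscDCov d₁ d₂).DConsistent (gscDCov d₁ d₂).acFamily ∧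
    (gscM d₁ d₂).DConsistent (gscM d₁ d₂).acFamily ∧
    (gscD d₁ d₂).DConsistent (gscD d₁ d₂).acFamily ∧
    (gscR d₁ d₂).DConsistent (gscR d₁ d₂).acFamily ∧
    (gscTau d₁ d₂).DConsistent (gscTau d₁ d₂).acFamily :=
  ⟨gscDCov_dConsistent d₁ d₂, gscM_dConsistent d₁ d₂, gscD_dConsistent d₁ d₂,
    gscR_dConsistent d₁ d₂, gscTau_dConsistent d₁ d₂⟩
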